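/- **Setting.** Let $n\ge 1$. A *weight* is a measurable function $w$ on $\mathbb{R}^n$ with $0<w(x)<\infty$ for a.e. $x$. Cubes have sides parallel to the axes, $\langle f\rangle_Q=\frac1{|Q|}\int_Q f\,dy$, and $Mf(x)=\sup_{Q\ni x}\langle |f|\rangle_Q$. A weight $w$ is in $A_1$ if $\|Mw/w\|_{L^\infty}<\infty$, in $A_p$ ($1<p<\infty$, $p'=p/(p-1)$) if $\sup_Q\langle w\rangle_Q\,\langle w^{1-p'}\rangle_Q^{p-1}<\infty$, and $A_\infty=\bigcup_{p\ge1}A_p$. For a weight $v\in L^1_{\mathrm{loc}}(\mathbb{R}^n)$ put $v(Q)=\int_Q v\,dx$ and $M_vf(x)=\sup_{Q\ni x}\frac1{v(Q)}\int_Q|f|\,v\,dy$. For $0<p<\infty$, $\|f\|_{L^p(w)}=\big(\int|f|^p w\,dx\big)^{1/p}$. Let $\mathbb{M}$ be the set of measurable functions on $\mathbb{R}^n$, up to equality a.e. A *Banach function space* $\mathbb{X}_v$ over $(\mathbb{R}^n,v\,dx)$ is given by a functional $\|\cdot\|_{\mathbb{X}_v}:\mathbb{M}\to[0,\infty]$ with: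 $\|f\|=\||f|\|$, and $\|f\|=0$ iff $f=0$ a.e.; $\|f+g\|\le\|f\|+\|g\|$; $\|\lambda f\|=|\lambda|\|f\|$; $|f|\le|g|$ a.e. implies $\|f\|\le\|g\|$; $|f_j|\uparrow|f|$ a.e. implies $\|f_j\|\uparrow\|f\|$; and, for every measurable $E$ with $v(E)<\infty$, $\|\mathbf 1_E\|<\infty$ and $\int_E|f|\,v\,dx\le C_E\|f\|$ for all $f$, with some $C_E<\infty$. A function that is infinite on a set of positive measure has norm $\infty$. The associate norm is $\|f\|_{\mathbb{X}_v'}=\sup\{\int_{\mathbb{R}^n}|fg|\,v\,dx:\ \|g\|_{\mathbb{X}_v}\le1\}$. **Theorem.** Let $u,v$ be weights on $\mathbb{R}^n$ with $v\in A_\infty\cap L^1_{\mathrm{loc}}(\mathbb{R}^n)$, let $\mathbb{X}_v$ be a Banach function space over $(\mathbb{R}^n,v\,dx)$, and let $\mathcal{F}$ be a family of pairs $(f,g)$ of measurable functions $f,g:\mathbb{R}^n\to[0,\infty]$. Suppose that for some $p_0\in(0,\infty)$ and every $w\in A_\infty$ there is a finite constant $C=C_w$ with $$\|f\|_{L^{p_0}(w)}\le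 C\,\|g\|_{L^{p_0}(w)}\qquad\text{for all }(f,g)\in\mathcal{F},$$ and that for some $K_0<\infty$ $$\|(M_vf)\,u^{-1}\|_{\mathbb{X}'_v}\le K_0\,\|f\,u^{-1}\|_{\mathbb{X}'_v}\qquad\text{for all } f\in\mathbb{M}.$$ Then for every $p\in(0,\infty)$ there is a finite constant $C$ such that $$\|f^p u\|_{\mathbb{X}_v}\le C\,\|g^p u\|_{\mathbb{X}_v}\qquad\text{for all }(f,g)\in\mathcal{F}.$$ Moreover, for all $p,q\in(0,\infty)$ there is a finite constant $C$ such that $$\Big\|\Big(\sum_j f_j^q\Big)^{p/q}u\Big\|_{\mathbb{X}_v}\le C\,\Big\|\Big(\sum_j g_j^q\Big)^{p/q}u\Big\|_{\mathbb{X}_v}$$ for all finite or infinite sequences $\{(f_j,g_j)\}_j\subset\mathcal{F}$. -/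

import Mathlib

open MeasureTheory Filter Topology
open scoped ENNReal NNReal

/- Functions, weights and norms take values in `[0, ∞] = ℝ≥0∞`.  A Lebesgue measurable function on
`ℝⁿ = Fin n → ℝ` is an `AEMeasurable` one, and a complex function `f` enters all the notions below
only through its modulus `|f|`. -/

/-- The (open) cube in `ℝⁿ` with sides parallel to the axes, centre `c` and side length `2 * r`. -/
def cube {n : ℕ} (c : Fin n → ℝ) (r : ℝ) : Set (Fin n → ℝ) :=
  {y | ∀ i, |y i - c i| < r}

/-- A weight: a measurable function `w` on `ℝⁿ` with `0 < w(x) < ∞` for a.e. `x`. -/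
def IsWeight {n : ℕ} (w : (Fin n → ℝ) → ℝ≥0∞) : Prop :=
  AEMeasurable w volume ∧ ∀ᵐ x ∂volume, 0 < w x ∧ w x < ∞

/-- The measure `v dx` on `ℝⁿ`. -/
noncomputable def weightMeasure {n : ℕ} (v : (Fin n → ℝ) → ℝ≥0∞) : Measure (Fin n → ℝ) :=
  volume.withDensity v

/-- `f ∈ L¹_loc(ℝⁿ)`, for a measurable function `f` with values in `[0, ∞]`. -/
def IsLocIntegrable {n : ℕ} (f : (Fin n → ℝ) → ℝ≥0∞) : Prop :=
  AEMeasurable f volume ∧ ∀ K : Set (Fin n → ℝ), IsCompact K → ∫⁻ x in K, f x < ∞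

/-- The uncentred maximal function over cubes with respect to a measure `μ` on `ℝⁿ`:
the supremum of the averages `μ(Q)⁻¹ ∫_Q f dμ` over all cubes `Q` containing `x`. -/
noncomputable def maximalFunction {n : ℕ} (μ : Measure (Fin n → ℝ))
    (f : (Fin n → ℝ) → ℝ≥0∞) (x : Fin n → ℝ) : ℝ≥0∞ :=
  ⨆ (c : Fin n → ℝ) (r : ℝ) (_ : 0 < r) (_ : x ∈ cube c r), ⨍⁻ y in cube c r, f y ∂μ

/-- The Hardy–Littlewood maximal operator `M`. -/
noncomputable def hlMaximal {n : ℕ} (f : (Fin n → ℝ) → ℝ≥0∞) : (Fin n → ℝ) → ℝ≥0∞ :=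
  maximalFunction volume f

/-- The weighted maximal operator `M_v f(x) = sup_{Q ∋ x} v(Q)⁻¹ ∫_Q f v dy`. -/
noncomputable def weightedMaximal {n : ℕ} (v f : (Fin n → ℝ) → ℝ≥0∞) : (Fin n → ℝ) → ℝ≥0∞ :=
  maximalFunction (weightMeasure v) f

/-- `[w]_{A_1} = ‖Mw / w‖_{L^∞}`. -/
noncomputable def a1Const {n : ℕ} (w : (Fin n → ℝ) → ℝ≥0∞) : ℝ≥0∞ :=
  essSup (fun x => hlMaximal w x / w x) volume

/-- `[w]_{A_p} = sup_Q (⨍_Q w) (⨍_Q w^{1-p'})^{p-1}` for `1 < p < ∞`, with `p' = p / (p - 1)`. -/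
noncomputable def apConst {n : ℕ} (p : ℝ) (w : (Fin n → ℝ) → ℝ≥0∞) : ℝ≥0∞ :=
  ⨆ (c : Fin n → ℝ) (r : ℝ) (_ : 0 < r),
    (⨍⁻ y in cube c r, w y ∂volume) *
      (⨍⁻ y in cube c r, w y ^ (1 - p.conjExponent) ∂volume) ^ (p - 1)

/-- The Muckenhoupt class `A_∞ = ⋃_{p ≥ 1} A_p`. -/
def IsAInfty {n : ℕ} (w : (Fin n → ℝ) → ℝ≥0∞) : Prop :=
  IsWeight w ∧ (a1Const w < ∞ ∨ ∃ p : ℝ, 1 < p ∧ apConst p w < ∞)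

/-- `‖f‖_{L^p(w)} = (∫ f^p w dx)^{1/p}` for `0 < p < ∞` and `f` with values in `[0, ∞]`. -/
noncomputable def weightedLpNorm {n : ℕ} (p : ℝ) (w f : (Fin n → ℝ) → ℝ≥0∞) : ℝ≥0∞ :=
  (∫⁻ x, f x ^ p ∂(weightMeasure w)) ^ (1 / p)

/-- A Banach function space over a measure space `(α, μ)`, given by its function norm.
As in Bennett–Sharpley, the norm is recorded on the cone of measurable functions with values in
`[0, ∞]`, and the norm of a complex function `f` is the norm of `|f|`; by the Fatou property such a
norm is determined by its values on finite functions, and a function which is infinite on a set of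
positive measure has infinite norm.  The values at non-measurable functions play no role. -/
structure BanachFunctionSpace {α : Type*} [MeasurableSpace α] (μ : Measure α) where
  /-- the function norm -/
  norm : (α → ℝ≥0∞) → ℝ≥0∞
  norm_eq_zero_iff : ∀ f, AEMeasurable f μ → (norm f = 0 ↔ f =ᵐ[μ] 0)
  norm_add_le : ∀ f g, AEMeasurable f μ → AEMeasurable g μ →
    norm (fun x => f x + g x) ≤ norm f + norm g
  norm_smul : ∀ (a : ℝ≥0) (f), AEMeasurable f μ → norm (fun x => (a : ℝ≥0∞) * f x) = a * norm f
  norm_mono : ∀ f g, AEMeasurable f μ → AEMeasurable g μ → f ≤ᵐ[μ] g → norm f ≤ norm g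
  norm_fatou : ∀ (f : ℕ → α → ℝ≥0∞) (g : α → ℝ≥0∞), (∀ j, AEMeasurable (f j) μ) →
    AEMeasurable g μ → (∀ᵐ x ∂μ, Monotone fun j => f j x) →
    (∀ᵐ x ∂μ, Tendsto (fun j => f j x) atTop (𝓝 (g x))) →
    Tendsto (fun j => norm (f j)) atTop (𝓝 (norm g))
  norm_indicator_lt_top : ∀ E : Set α, MeasurableSet E → μ E < ∞ →
    norm (E.indicator fun _ => 1) < ∞
  setLIntegral_le : ∀ E : Set α, MeasurableSet E → μ E < ∞ →
    ∃ C : ℝ≥0, ∀ f, AEMeasurable f μ → ∫⁻ x in E, f x ∂μ ≤ C * norm f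

/-- The associate norm `‖f‖_{X'} = sup {∫ |f g| dμ : ‖g‖_X ≤ 1}`. -/
noncomputable def BanachFunctionSpace.associateNorm {α : Type*} [MeasurableSpace α]
    {μ : Measure α} (X : BanachFunctionSpace μ) (f : α → ℝ≥0∞) : ℝ≥0∞ :=
  ⨆ (g : α → ℝ≥0∞) (_ : AEMeasurable g μ) (_ : X.norm g ≤ 1), ∫⁻ x, f x * g x ∂μ

/-! ### Cubes and the maximal function of a measure -/

/-! The proof is Rubio de Francia extrapolation, carried out with the maximal operator `M_w` of the
measure `w dx`, where `w` is an `A_∞` weight. Suppose `M_w` is bounded by `K` in some countably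
sublinear functional `Φ`. Then `R h = ∑ (2K)⁻ᵏ M_wᵏ h` majorises `h`, satisfies `Φ (R h) ≤ 2 Φ h`,
and is an `A_1` weight relative to `w dx`: `M_w (R h) ≤ 2K R h`. By Hölder, `A_1(w dx)` weights and
their negative powers send `w` to another `A_∞` weight, so the hypothesis applies to `(R h) w` or
`(R h)⁻ᵗ w`.

The constant in the hypothesis may depend on the weight in an arbitrary way, so it need not be
uniform over the weights `(R h) w`. Uniformity comes from gluing: if no constant works, a sequence
of increasingly bad examples is summed with geometric coefficients into one function `H`. The single
weight built from `R H` then controls the whole sequence, and its one finite constant gives a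
contradiction (`LpComparison.exists_dual_bound`, `LpComparison.of_gt`).

This is used three times. For exponents `p > p₀`, `Φ` is the `Lˢ(w)` norm with `s` conjugate to `p /
p₀`; for `p < p₀`, Hölder's inequality is used with a negative power of `R H`. Both need the
boundedness of `M_w` on `Lˢ(w)` for `s > 1`, which follows from doubling of `w dx`. Once every
exponent is available, the target inequality is the dual bound with `w = v` and `Φ h = ‖h
u⁻¹‖_{X'}`, for which the boundedness of `M_v` is assumed. Returning from `X'` to `X` is the
Lorentz–Luxemburg theorem `X'' = X`, proved here by separating points from the part of the unit ball
lying in `L²`.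

The vector-valued inequality is the scalar one for the family of `ℓ^q` sums, which inherits the
weighted comparison at exponent `q` by integrating term by term. -/

theorem cube_eq_ball {n : ℕ} (c : Fin n → ℝ) {r : ℝ} (hr : 0 < r) :
    cube c r = Metric.ball c r := by
  ext y
  simp [cube, Metric.mem_ball, dist_pi_lt_iff hr, Real.dist_eq]

theorem isOpen_cube {n : ℕ} (c : Fin n → ℝ) {r : ℝ} (hr : 0 < r) : IsOpen (cube c r) := by
  rw [cube_eq_ball c hr]
  exact Metric.isOpen_ball

theorem measurableSet_cube {n : ℕ} (c : Fin n → ℝ) {r : ℝ} (hr : 0 < r) :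
    MeasurableSet (cube c r) :=
  (isOpen_cube c hr).measurableSet

theorem lt_maximalFunction_iff {n : ℕ} {μ : Measure (Fin n → ℝ)} {f : (Fin n → ℝ) → ℝ≥0∞}
    {x : Fin n → ℝ} {t : ℝ≥0∞} :
    t < maximalFunction μ f x ↔
      ∃ c r, 0 < r ∧ x ∈ cube c r ∧ t < ⨍⁻ y in cube c r, f y ∂μ := by
  simp only [maximalFunction, lt_iSup_iff, exists_prop]

theorem isOpen_lt_maximalFunction {n : ℕ} (μ : Measure (Fin n → ℝ))
    (f : (Fin n → ℝ) → ℝ≥0∞) (t : ℝ≥0∞) : IsOpen {x | t < maximalFunction μ f x} := by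
  rw [isOpen_iff_forall_mem_open]
  intro x hx
  obtain ⟨c, r, hr, hxc, ht⟩ := lt_maximalFunction_iff.1 hx
  exact ⟨cube c r, fun y hy => lt_maximalFunction_iff.2 ⟨c, r, hr, hy, ht⟩, isOpen_cube c hr, hxc⟩

theorem measurable_maximalFunction {n : ℕ} (μ : Measure (Fin n → ℝ))
    (f : (Fin n → ℝ) → ℝ≥0∞) : Measurable (maximalFunction μ f) :=
  measurable_of_Ioi fun t => (isOpen_lt_maximalFunction μ f t).measurableSet

theorem laverage_le_maximalFunction {n : ℕ} (μ : Measure (Fin n → ℝ))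
    (f : (Fin n → ℝ) → ℝ≥0∞) {c x : Fin n → ℝ} {r : ℝ} (hr : 0 < r) (hx : x ∈ cube c r) :
    ⨍⁻ y in cube c r, f y ∂μ ≤ maximalFunction μ f x :=
  le_of_forall_lt fun _ ht => lt_maximalFunction_iff.2 ⟨c, r, hr, hx, ht⟩

theorem maximalFunction_le_iff {n : ℕ} {μ : Measure (Fin n → ℝ)} {f : (Fin n → ℝ) → ℝ≥0∞}
    {x : Fin n → ℝ} {t : ℝ≥0∞} :
    maximalFunction μ f x ≤ t ↔
      ∀ c r, 0 < r → x ∈ cube c r → ⨍⁻ y in cube c r, f y ∂μ ≤ t := by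
  simp [maximalFunction]

theorem maximalFunction_congr {n : ℕ} {μ : Measure (Fin n → ℝ)} {f g : (Fin n → ℝ) → ℝ≥0∞}
    (h : f =ᵐ[μ] g) : maximalFunction μ f = maximalFunction μ g := by
  funext x
  simp only [maximalFunction]
  refine iSup_congr fun c => iSup_congr fun r => iSup_congr fun _ => iSup_congr fun _ => ?_
  exact laverage_congr (ae_restrict_of_ae h)

theorem maximalFunction_tsum_le {n : ℕ} (μ : Measure (Fin n → ℝ))
    {f : ℕ → (Fin n → ℝ) → ℝ≥0∞} (hf : ∀ k, AEMeasurable (f k) μ) (x : Fin n → ℝ) :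
    maximalFunction μ (fun y => ∑' k, f k y) x ≤ ∑' k, maximalFunction μ (f k) x := by
  refine maximalFunction_le_iff.2 fun c r hr hx => ?_
  rw [setLAverage_eq, lintegral_tsum fun k => (hf k).restrict, ENNReal.div_eq_inv_mul,
    ← ENNReal.tsum_mul_left]
  refine ENNReal.tsum_le_tsum fun k => ?_
  rw [← ENNReal.div_eq_inv_mul, ← setLAverage_eq]
  exact laverage_le_maximalFunction μ (f k) hr hx

theorem maximalFunction_const_mul_le {n : ℕ} (μ : Measure (Fin n → ℝ)) (a : ℝ≥0)
    (f : (Fin n → ℝ) → ℝ≥0∞) (x : Fin n → ℝ) :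
    maximalFunction μ (fun y => a * f y) x ≤ a * maximalFunction μ f x := by
  refine maximalFunction_le_iff.2 fun c r hr hx => ?_
  rw [setLAverage_eq, lintegral_const_mul' _ _ ENNReal.coe_ne_top, mul_div_assoc, ← setLAverage_eq]
  gcongr
  exact laverage_le_maximalFunction μ f hr hx

/-! ### The Rubio de Francia algorithm -/

/-- A functional on nonnegative functions to which the Rubio de Francia algorithm applies. -/
structure IsCountablySublinear {α : Type*} [MeasurableSpace α] (μ : Measure α)
    (Φ : (α → ℝ≥0∞) → ℝ≥0∞) : Prop where
  tsum_le : ∀ h : ℕ → α → ℝ≥0∞, (∀ k, AEMeasurable (h k) μ) →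
    Φ (fun x => ∑' k, h k x) ≤ ∑' k, Φ (h k)
  const_mul_le : ∀ (a : ℝ≥0) (h : α → ℝ≥0∞), AEMeasurable h μ → Φ (fun x => a * h x) ≤ a * Φ h
  ae_lt_top : ∀ h, AEMeasurable h μ → Φ h < ∞ → ∀ᵐ x ∂μ, h x < ∞

/-- The Rubio de Francia iteration `∑ₖ (2K)⁻ᵏ Mᵏ h`. -/
noncomputable def rubioDeFrancia {n : ℕ} (μ : Measure (Fin n → ℝ)) (K : ℝ≥0)
    (h : (Fin n → ℝ) → ℝ≥0∞) (x : Fin n → ℝ) : ℝ≥0∞ :=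
  ∑' k : ℕ, (((2 * K)⁻¹ ^ k : ℝ≥0) : ℝ≥0∞) * (maximalFunction μ)^[k] h x

section RubioDeFrancia

variable {n : ℕ} {μ : Measure (Fin n → ℝ)} {K : ℝ≥0} {h : (Fin n → ℝ) → ℝ≥0∞}

theorem aemeasurable_iterate_maximalFunction (hh : AEMeasurable h μ) (k : ℕ) :
    AEMeasurable ((maximalFunction μ)^[k] h) μ := by
  cases k with
  | zero => exact hh
  | succ k =>
    rw [Function.iterate_succ_apply']
    exact (measurable_maximalFunction μ _).aemeasurable

theorem aemeasurable_rubioDeFrancia (hh : AEMeasurable h μ) :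
    AEMeasurable (rubioDeFrancia μ K h) μ :=
  AEMeasurable.tsum fun k => (aemeasurable_iterate_maximalFunction hh k).const_mul _

theorem le_rubioDeFrancia (x : Fin n → ℝ) : h x ≤ rubioDeFrancia μ K h x := by
  refine le_trans ?_ (ENNReal.le_tsum 0)
  simp

/-- By countable sublinearity the maximal function shifts the series by one index, and the shift
costs exactly one factor `2 * K`. -/
theorem maximalFunction_rubioDeFrancia_le (hK : 0 < K) (hh : AEMeasurable h μ) (x : Fin n → ℝ) :
    maximalFunction μ (rubioDeFrancia μ K h) x ≤ (2 * K : ℝ≥0) * rubioDeFrancia μ K h x := by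
  calc maximalFunction μ (rubioDeFrancia μ K h) x
      ≤ ∑' k : ℕ, (((2 * K)⁻¹ ^ k : ℝ≥0) : ℝ≥0∞) * (maximalFunction μ)^[k + 1] h x := by
        refine (maximalFunction_tsum_le μ
          (fun k => (aemeasurable_iterate_maximalFunction hh k).const_mul _) x).trans ?_
        refine ENNReal.tsum_le_tsum fun k => ?_
        rw [Function.iterate_succ_apply']
        exact maximalFunction_const_mul_le μ _ _ x
    _ = (2 * K : ℝ≥0) * ∑' k : ℕ,
          (((2 * K)⁻¹ ^ (k + 1) : ℝ≥0) : ℝ≥0∞) * (maximalFunction μ)^[k + 1] h x := by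
        rw [← ENNReal.tsum_mul_left]
        refine tsum_congr fun k => ?_
        rw [← mul_assoc, ← ENNReal.coe_mul, pow_succ, mul_comm (2 * K), mul_assoc,
          inv_mul_cancel₀ (by positivity), mul_one]
    _ ≤ (2 * K : ℝ≥0) * rubioDeFrancia μ K h x := by
        gcongr
        exact ENNReal.tsum_comp_le_tsum_of_injective (add_left_injective 1)
          (fun k => (((2 * K)⁻¹ ^ k : ℝ≥0) : ℝ≥0∞) * (maximalFunction μ)^[k] h x)

theorem IsCountablySublinear.rubioDeFrancia_le {Φ : ((Fin n → ℝ) → ℝ≥0∞) → ℝ≥0∞}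
    (hΦ : IsCountablySublinear μ Φ) (hK : 0 < K)
    (hM : ∀ f, AEMeasurable f μ → Φ (maximalFunction μ f) ≤ K * Φ f) (hh : AEMeasurable h μ) :
    Φ (rubioDeFrancia μ K h) ≤ 2 * Φ h := by
  have hit : ∀ k : ℕ, Φ ((maximalFunction μ)^[k] h) ≤ (K : ℝ≥0∞) ^ k * Φ h := by
    intro k
    induction k with
    | zero => simp
    | succ k ih =>
      rw [Function.iterate_succ_apply', pow_succ', mul_assoc]
      exact (hM _ (aemeasurable_iterate_maximalFunction hh k)).trans (by gcongr)
  calc Φ (rubioDeFrancia μ K h)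
      ≤ ∑' k : ℕ, (((2 * K)⁻¹ ^ k : ℝ≥0) : ℝ≥0∞) * ((K : ℝ≥0∞) ^ k * Φ h) := by
        refine (hΦ.tsum_le _
          fun k => (aemeasurable_iterate_maximalFunction hh k).const_mul _).trans ?_
        refine ENNReal.tsum_le_tsum fun k => ?_
        exact (hΦ.const_mul_le _ _ (aemeasurable_iterate_maximalFunction hh k)).trans
          (by gcongr; exact hit k)
    _ = ∑' k : ℕ, (2⁻¹ : ℝ≥0∞) ^ k * Φ h := by
        refine tsum_congr fun k => ?_
        rw [← mul_assoc, ← ENNReal.coe_pow, ← ENNReal.coe_mul, ← mul_pow, mul_inv, mul_assoc,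
          inv_mul_cancel₀ hK.ne', mul_one, ENNReal.coe_pow, ENNReal.coe_inv two_ne_zero]
        norm_num
    _ = 2 * Φ h := by
        rw [ENNReal.tsum_mul_right, ENNReal.tsum_geometric, ENNReal.one_sub_inv_two, inv_inv]

theorem maximalFunction_pos [IsLocallyFiniteMeasure μ] (hh : AEMeasurable h μ)
    (h0 : ¬ h =ᵐ[μ] 0) (x : Fin n → ℝ) : 0 < maximalFunction μ h x := by
  by_contra hx
  have hx : maximalFunction μ h x ≤ 0 := not_lt.1 hx
  apply h0
  have hball : ∀ k : ℕ, h =ᵐ[μ.restrict (Metric.ball x (k + 1 : ℝ))] 0 := by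
    intro k
    have hk : (0 : ℝ) < k + 1 := by positivity
    have hav := maximalFunction_le_iff.1 hx x (k + 1) hk
      (by rw [cube_eq_ball x hk]; exact Metric.mem_ball_self hk)
    rw [cube_eq_ball x hk, setLAverage_eq, nonpos_iff_eq_zero, ENNReal.div_eq_zero_iff] at hav
    refine (lintegral_eq_zero_iff' hh.restrict).1 (hav.resolve_right measure_ball_lt_top.ne)
  have : h =ᵐ[μ.restrict (⋃ k : ℕ, Metric.ball x (k + 1 : ℝ))] 0 :=
    (ae_restrict_iUnion_iff _ _).2 hball
  have hU : (⋃ k : ℕ, Metric.ball x (k + 1 : ℝ)) = Set.univ := by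
    refine Set.eq_univ_of_forall fun y => ?_
    obtain ⟨k, hk⟩ := exists_nat_gt (dist y x)
    exact Set.mem_iUnion.2 ⟨k, Metric.mem_ball.2 (by linarith)⟩
  rwa [hU, Measure.restrict_univ] at this

/-- Positivity everywhere is needed for the iteration to be a weight. The term `k = 1` supplies it
even where `h` vanishes. -/
theorem rubioDeFrancia_pos [IsLocallyFiniteMeasure μ] (hK : 0 < K) (hh : AEMeasurable h μ)
    (h0 : ¬ h =ᵐ[μ] 0) (x : Fin n → ℝ) : 0 < rubioDeFrancia μ K h x := by
  refine lt_of_lt_of_le ?_ (ENNReal.le_tsum 1)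
  have : (0 : ℝ≥0) < (2 * K)⁻¹ ^ 1 := by positivity
  exact ENNReal.mul_pos (ENNReal.coe_pos.2 this).ne' (maximalFunction_pos hh h0 x).ne'

end RubioDeFrancia

/-! ### Weak and strong type bounds -/

/-- Weak type (1,1) from the Vitali covering lemma. Inner regularity of the open level set reduces
it to compact sets, hence to finitely many cubes. -/
theorem mul_measure_lt_maximalFunction_le {n : ℕ} {μ : Measure (Fin n → ℝ)}
    [IsLocallyFiniteMeasure μ] {D : ℝ≥0∞}
    (hD : ∀ (c : Fin n → ℝ) (r : ℝ), 0 < r → μ (cube c (5 * r)) ≤ D * μ (cube c r))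
    (f : (Fin n → ℝ) → ℝ≥0∞) (t : ℝ≥0∞) :
    t * μ {x | t < maximalFunction μ f x} ≤ D * ∫⁻ x, f x ∂μ := by
  rw [(isOpen_lt_maximalFunction μ f t).measure_eq_iSup_isCompact, ENNReal.mul_iSup]
  refine iSup_le fun L => ?_
  rw [ENNReal.mul_iSup]
  refine iSup_le fun hL => ?_
  rw [ENNReal.mul_iSup]
  refine iSup_le fun hLc => ?_
  let ι := {b : (Fin n → ℝ) × ℝ // 0 < b.2 ∧ t * μ (cube b.1 b.2) ≤ ∫⁻ y in cube b.1 b.2, f y ∂μ}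
  obtain ⟨s, hs⟩ := hLc.elim_finite_subcover (fun i : ι => cube i.1.1 i.1.2)
    (fun i => isOpen_cube _ i.2.1) (by
      intro x hx
      obtain ⟨c, r, hr, hxc, ht⟩ := lt_maximalFunction_iff.1 (hL hx)
      rw [setLAverage_eq] at ht
      exact Set.mem_iUnion.2 ⟨⟨(c, r), hr, ENNReal.mul_le_of_le_div ht.le⟩, hxc⟩)
  obtain ⟨R, hR⟩ := (s.finite_toSet.image fun i : ι => i.1.2).bddAbove
  -- Any Vitali factor above 3 would do. With 4, the enlarged closed ball lies inside the open cube
  -- of radius `5 * r`, which explains the 5 in `hD`.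
  obtain ⟨u, hus, hdisj, hcov⟩ := Vitali.exists_disjoint_subfamily_covering_enlargement_closedBall
    (s : Set ι) (fun i => i.1.1) (fun i => i.1.2) R
    (fun i hi => hR (Set.mem_image_of_mem _ hi)) 4 (by norm_num)
  have hufin : u.Finite := s.finite_toSet.subset hus
  have hsub : L ⊆ ⋃ i ∈ u, cube i.1.1 (5 * i.1.2) := by
    intro x hx
    obtain ⟨i, his, hi⟩ := Set.mem_iUnion₂.1 (hs hx)
    obtain ⟨j, hj, hij⟩ := hcov i his
    refine Set.mem_iUnion₂.2 ⟨j, hj, ?_⟩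
    rw [cube_eq_ball _ i.2.1] at hi
    have hj0 := j.2.1
    rw [cube_eq_ball _ (by linarith)]
    exact Metric.closedBall_subset_ball (by linarith) (hij (Metric.ball_subset_closedBall hi))
  have hdisj' : u.PairwiseDisjoint fun i : ι => cube i.1.1 i.1.2 := by
    refine hdisj.mono fun i => ?_
    rw [cube_eq_ball _ i.2.1]
    exact Metric.ball_subset_closedBall
  calc t * μ L ≤ t * ∑' i : u, μ (cube i.1.1.1 (5 * i.1.1.2)) := by
        gcongr
        exact (measure_mono hsub).trans (measure_biUnion_le μ hufin.countable _)
    _ ≤ t * ∑' i : u, D * μ (cube i.1.1.1 i.1.1.2) := by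
        gcongr with i
        exact hD _ _ i.1.2.1
    _ = D * ∑' i : u, t * μ (cube i.1.1.1 i.1.1.2) := by
        rw [ENNReal.tsum_mul_left, ENNReal.tsum_mul_left, mul_left_comm]
    _ ≤ D * ∑' i : u, ∫⁻ y in cube i.1.1.1 i.1.1.2, f y ∂μ := by
        gcongr with i
        exact i.1.2.2
    _ = D * ∫⁻ y in ⋃ i ∈ u, cube i.1.1 i.1.2, f y ∂μ := by
        rw [lintegral_biUnion hufin.countable (fun i _ => measurableSet_cube _ i.2.1) hdisj']
    _ ≤ D * ∫⁻ x, f x ∂μ := by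
        gcongr
        exact Measure.restrict_le_self

/-- The layer cake formula for a single value, including `a = ∞`. The finite case is the layer cake
formula for a constant function under a Dirac mass. -/
theorem lintegral_indicator_ofReal_lt_eq_rpow {s : ℝ} (hs : 0 < s) (a : ℝ≥0∞) :
    ∫⁻ t in Set.Ioi (0 : ℝ), {t : ℝ | ENNReal.ofReal t < a}.indicator
      (fun t => ENNReal.ofReal (s * t ^ (s - 1))) t = a ^ s := by
  have hfin : ∀ b : ℝ≥0, ∫⁻ t in Set.Ioi (0 : ℝ), {t : ℝ | ENNReal.ofReal t < b}.indicator
      (fun t => ENNReal.ofReal (s * t ^ (s - 1))) t = (b : ℝ≥0∞) ^ s := by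
    intro b
    have key := lintegral_rpow_eq_lintegral_meas_lt_mul (Measure.dirac ()) (f := fun _ => (b : ℝ))
      (ae_of_all _ fun _ => b.2) aemeasurable_const hs
    rw [lintegral_dirac, ← lintegral_const_mul' _ _ ENNReal.ofReal_ne_top] at key
    rw [← ENNReal.ofReal_coe_nnreal, ENNReal.ofReal_rpow_of_nonneg b.coe_nonneg hs.le, key]
    refine setLIntegral_congr_fun measurableSet_Ioi fun t ht => ?_
    have ht : 0 < t := ht
    by_cases htb : t < b
    · rw [Set.indicator_of_mem (show t ∈ {t : ℝ | ENNReal.ofReal t < ENNReal.ofReal b} from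
        (ENNReal.ofReal_lt_ofReal_iff (ht.trans htb)).2 htb)]
      simp [htb, ENNReal.ofReal_mul hs.le]
    · have : ¬ ENNReal.ofReal t < ENNReal.ofReal b := fun h =>
        htb (ENNReal.ofReal_lt_ofReal_iff'.1 h).1
      rw [Set.indicator_of_notMem (by simpa using this)]
      simp [htb]
  induction a with
  | coe b => exact hfin b
  | top =>
    rw [ENNReal.top_rpow_of_pos hs, eq_top_iff]
    refine ENNReal.le_of_forall_nnreal_lt fun N _ => ?_
    have hN := hfin (N ^ (1 / s))
    rw [ENNReal.coe_rpow_of_nonneg _ (by positivity), ← ENNReal.rpow_mul,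
      one_div_mul_cancel hs.ne', ENNReal.rpow_one] at hN
    rw [← hN]
    refine lintegral_mono fun t => ?_
    refine Set.indicator_le_indicator_of_subset (fun t ht => ?_) (fun _ => zero_le) t
    simp

/-- Where `2 * f ≤ t`, the function contributes at most `t / 2` to any average. Nothing is required
of `μ`, since `μ Q / μ Q ≤ 1` even for degenerate cubes. -/
theorem maximalFunction_le_add_half {n : ℕ} (μ : Measure (Fin n → ℝ)) (f : (Fin n → ℝ) → ℝ≥0∞)
    (t : ℝ≥0∞) (x : Fin n → ℝ) :
    maximalFunction μ f x ≤ maximalFunction μ ({y | t < 2 * f y}.indicator f) x + t / 2 := by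
  refine maximalFunction_le_iff.2 fun c r hr hx => ?_
  refine le_trans ?_ (add_le_add_left (laverage_le_maximalFunction μ _ hr hx) _)
  rw [setLAverage_eq, setLAverage_eq]
  calc (∫⁻ y in cube c r, f y ∂μ) / μ (cube c r)
      ≤ (∫⁻ y in cube c r, ({y | t < 2 * f y}.indicator f y + t / 2) ∂μ) / μ (cube c r) := by
        gcongr with y
        by_cases hy : t < 2 * f y
        · simp [Set.indicator, hy]
        · simp only [Set.indicator, Set.mem_ofPred_eq, hy, if_false, zero_add]
          rw [ENNReal.le_div_iff_mul_le (by simp) (by simp), mul_comm]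
          exact not_lt.1 hy
    _ = (∫⁻ y in cube c r, {y | t < 2 * f y}.indicator f y ∂μ) / μ (cube c r)
          + (t / 2 * μ (cube c r)) / μ (cube c r) := by
        rw [lintegral_add_right _ measurable_const, setLIntegral_const, ENNReal.add_div]
    _ ≤ _ := by
        refine add_le_add le_rfl ?_
        rw [mul_div_assoc]
        exact mul_le_of_le_one_right' ENNReal.div_self_le_one

/-- Marcinkiewicz interpolation between the weak (1,1) bound and the trivial `L^∞` bound: at height
`t` only the part of `f` above `t / 2` matters. -/
theorem exists_lintegral_maximalFunction_rpow_le {n : ℕ} {μ : Measure (Fin n → ℝ)}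
    [IsLocallyFiniteMeasure μ] {D : ℝ≥0}
    (hD : ∀ (c : Fin n → ℝ) (r : ℝ), 0 < r → μ (cube c (5 * r)) ≤ D * μ (cube c r))
    {s : ℝ} (hs : 1 < s) :
    ∃ C : ℝ≥0, ∀ f : (Fin n → ℝ) → ℝ≥0∞, AEMeasurable f μ →
      ∫⁻ x, maximalFunction μ f x ^ s ∂μ ≤ C * ∫⁻ x, f x ^ s ∂μ := by
  have hs1 : 0 < s - 1 := sub_pos.2 hs
  have hs0 : 0 < s := by linarith
  -- `D` is the weak type constant. The factor `2s/(s-1)` turns `s t^{s-1} · (2/t)` into `(s-1)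
  -- t^{s-2}`, whose integral up to `2f` is `(2f)^{s-1}`; this gives `2^{s-1}`.
  refine ⟨D * (2 * s / (s - 1)).toNNReal * 2 ^ (s - 1), fun f hf => ?_⟩
  suffices H : ∀ f : (Fin n → ℝ) → ℝ≥0∞, Measurable f →
      ∫⁻ x, maximalFunction μ f x ^ s ∂μ ≤
        (D * (2 * s / (s - 1)).toNNReal * 2 ^ (s - 1) : ℝ≥0) * ∫⁻ x, f x ^ s ∂μ by
    rw [maximalFunction_congr hf.ae_eq_mk]
    refine (H _ hf.measurable_mk).trans_eq ?_
    congr 1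
    exact lintegral_congr_ae (hf.ae_eq_mk.symm.fun_comp (· ^ s))
  intro f hf
  have hmeas : ∀ (g : (Fin n → ℝ) → ℝ≥0∞), Measurable g → ∀ φ : ℝ → ℝ≥0∞, Measurable φ →
      Measurable fun z : (Fin n → ℝ) × ℝ => {t : ℝ | ENNReal.ofReal t < g z.1}.indicator φ z.2 := by
    intro g hg φ hφ
    have hset : MeasurableSet {z : (Fin n → ℝ) × ℝ | ENNReal.ofReal z.2 < g z.1} :=
      measurableSet_lt (by fun_prop) (by fun_prop)
    exact (hφ.comp measurable_snd).indicator hset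
  have hφ : ∀ a : ℝ, Measurable fun t : ℝ => ENNReal.ofReal (a * t ^ (a - 1)) := by
    intro a
    fun_prop
  have hM := measurable_maximalFunction μ f
  set B : ℝ≥0∞ := (D : ℝ≥0∞) * ENNReal.ofReal (2 * s / (s - 1)) with hB
  calc ∫⁻ x, maximalFunction μ f x ^ s ∂μ
      = ∫⁻ x, (∫⁻ t in Set.Ioi (0 : ℝ), {t : ℝ | ENNReal.ofReal t < maximalFunction μ f x}.indicator
          (fun t => ENNReal.ofReal (s * t ^ (s - 1))) t) ∂μ := by
        simp_rw [lintegral_indicator_ofReal_lt_eq_rpow hs0]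
    _ = ∫⁻ t in Set.Ioi (0 : ℝ), ∫⁻ x, {t : ℝ | ENNReal.ofReal t < maximalFunction μ f x}.indicator
          (fun t => ENNReal.ofReal (s * t ^ (s - 1))) t ∂μ :=
        lintegral_lintegral_swap (hmeas _ hM _ (hφ s)).aemeasurable
    _ ≤ ∫⁻ t in Set.Ioi (0 : ℝ), ∫⁻ x, B * f x * {t : ℝ | ENNReal.ofReal t < 2 * f x}.indicator
          (fun t => ENNReal.ofReal ((s - 1) * t ^ (s - 1 - 1))) t ∂μ := by
        refine setLIntegral_mono' measurableSet_Ioi fun t ht => ?_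
        have ht : 0 < t := ht
        set T := ENNReal.ofReal t with hT
        have hw := mul_measure_lt_maximalFunction_le hD ({y | T < 2 * f y}.indicator f) (T / 2)
        have hsub : {x | T < maximalFunction μ f x} ⊆
            {x | T / 2 < maximalFunction μ ({y | T < 2 * f y}.indicator f) x} := by
          intro x hx
          have h1 := lt_of_lt_of_le hx (maximalFunction_le_add_half μ f T x)
          by_contra h2
          have h3 := add_le_add_left (not_lt.1 h2) (T / 2)
          rw [ENNReal.add_halves] at h3
          exact absurd h1 (not_lt.2 h3)
        have hset : MeasurableSet {x | T < maximalFunction μ f x} :=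
          (isOpen_lt_maximalFunction μ f T).measurableSet
        have hset2 : MeasurableSet {x | T < 2 * f x} :=
          measurableSet_lt measurable_const (by fun_prop)
        have e1 : ∀ x, {t : ℝ | ENNReal.ofReal t < maximalFunction μ f x}.indicator
            (fun t => ENNReal.ofReal (s * t ^ (s - 1))) t =
            {x | T < maximalFunction μ f x}.indicator
              (fun _ => ENNReal.ofReal (s * t ^ (s - 1))) x := fun x => rfl
        have e2 : ∀ x, B * f x * {t : ℝ | ENNReal.ofReal t < 2 * f x}.indicator
            (fun t => ENNReal.ofReal ((s - 1) * t ^ (s - 1 - 1))) t =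
            B * ENNReal.ofReal ((s - 1) * t ^ (s - 1 - 1)) *
              {y | T < 2 * f y}.indicator f x := by
          intro x
          by_cases hx : T < 2 * f x
          · rw [Set.indicator_of_mem (show t ∈ {t : ℝ | ENNReal.ofReal t < 2 * f x} from hx),
              Set.indicator_of_mem (show x ∈ {y | T < 2 * f y} from hx)]
            ring
          · rw [Set.indicator_of_notMem (show t ∉ {t : ℝ | ENNReal.ofReal t < 2 * f x} from hx),
              Set.indicator_of_notMem (show x ∉ {y | T < 2 * f y} from hx)]
            simp
        simp_rw [e1, e2]
        rw [lintegral_indicator_const hset, lintegral_const_mul _ (hf.indicator hset2)]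
        have hcoef : ENNReal.ofReal (s * t ^ (s - 1)) =
            ENNReal.ofReal (2 * s / (s - 1)) * ENNReal.ofReal ((s - 1) * t ^ (s - 1 - 1)) *
              (T / 2) := by
          have h2 : T / 2 = ENNReal.ofReal (t / 2) := by
            rw [ENNReal.ofReal_div_of_pos two_pos]; simp [hT]
          rw [h2, ← ENNReal.ofReal_mul (by positivity), ← ENNReal.ofReal_mul (by positivity)]
          congr 1
          rw [Real.rpow_sub_one ht.ne' (s - 1)]
          field_simp
        calc ENNReal.ofReal (s * t ^ (s - 1)) * μ {x | T < maximalFunction μ f x}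
            ≤ ENNReal.ofReal (s * t ^ (s - 1)) *
              μ {x | T / 2 < maximalFunction μ ({y | T < 2 * f y}.indicator f) x} := by
              gcongr
          _ = ENNReal.ofReal (2 * s / (s - 1)) * ENNReal.ofReal ((s - 1) * t ^ (s - 1 - 1)) *
              (T / 2 * μ {x | T / 2 < maximalFunction μ ({y | T < 2 * f y}.indicator f) x}) := by
              rw [hcoef]; ring
          _ ≤ ENNReal.ofReal (2 * s / (s - 1)) * ENNReal.ofReal ((s - 1) * t ^ (s - 1 - 1)) *
              (D * ∫⁻ x, {y | T < 2 * f y}.indicator f x ∂μ) := by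
              gcongr
          _ = _ := by
              rw [hB]
              ring
    _ = ∫⁻ x, (∫⁻ t in Set.Ioi (0 : ℝ), B * f x * {t : ℝ | ENNReal.ofReal t < 2 * f x}.indicator
          (fun t => ENNReal.ofReal ((s - 1) * t ^ (s - 1 - 1))) t) ∂μ := by
        refine (lintegral_lintegral_swap (Measurable.aemeasurable ?_)).symm
        exact ((hf.comp measurable_fst).const_mul B).mul
          (hmeas (fun x => 2 * f x) (by fun_prop) _ (hφ (s - 1)))
    _ = ∫⁻ x, B * f x * (2 * f x) ^ (s - 1) ∂μ := by
        refine lintegral_congr fun x => ?_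
        rw [lintegral_const_mul, lintegral_indicator_ofReal_lt_eq_rpow hs1]
        exact (hφ (s - 1)).indicator
          (measurableSet_lt ENNReal.measurable_ofReal measurable_const)
    _ = ∫⁻ x, (B * 2 ^ (s - 1)) * f x ^ s ∂μ := by
        refine lintegral_congr fun x => ?_
        have : f x ^ s = f x * f x ^ (s - 1) := by
          conv_lhs => rw [show s = 1 + (s - 1) by ring]
          rw [ENNReal.rpow_add_of_nonneg _ _ zero_le_one hs1.le, ENNReal.rpow_one]
        rw [ENNReal.mul_rpow_of_nonneg _ _ hs1.le, this]
        ring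
    _ = _ := by
        rw [lintegral_const_mul _ (by fun_prop), ENNReal.coe_mul, ENNReal.coe_mul,
          ENNReal.coe_rpow_of_nonneg _ hs1.le, hB]
        rfl

/-! ### Weighted measures -/

section Weight

variable {n : ℕ} {w : (Fin n → ℝ) → ℝ≥0∞}

theorem IsWeight.lintegral_weightMeasure (hw : IsWeight w) (f : (Fin n → ℝ) → ℝ≥0∞) :
    ∫⁻ x, f x ∂(weightMeasure w) = ∫⁻ x, f x * w x := by
  rw [weightMeasure, lintegral_withDensity_eq_lintegral_mul_non_measurable₀ _ hw.1
    (hw.2.mono fun x hx => hx.2)]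
  simp [mul_comm]

theorem IsWeight.setLIntegral_weightMeasure (hw : IsWeight w) (f : (Fin n → ℝ) → ℝ≥0∞)
    {s : Set (Fin n → ℝ)} (hs : MeasurableSet s) :
    ∫⁻ x in s, f x ∂(weightMeasure w) = ∫⁻ x in s, f x * w x := by
  rw [weightMeasure, restrict_withDensity hs,
    lintegral_withDensity_eq_lintegral_mul_non_measurable₀ _ hw.1.restrict
    (ae_restrict_of_ae (hw.2.mono fun x hx => hx.2))]
  simp [mul_comm]

theorem weightMeasure_cube (w : (Fin n → ℝ) → ℝ≥0∞) (c : Fin n → ℝ) {r : ℝ} (hr : 0 < r) :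
    weightMeasure w (cube c r) = ∫⁻ x in cube c r, w x :=
  withDensity_apply _ (measurableSet_cube c hr)

theorem weightMeasure_absolutelyContinuous (w : (Fin n → ℝ) → ℝ≥0∞) :
    weightMeasure w ≪ volume :=
  withDensity_absolutelyContinuous _ _

theorem IsWeight.volume_absolutelyContinuous (hw : IsWeight w) : volume ≪ weightMeasure w :=
  withDensity_absolutelyContinuous' hw.1 (hw.2.mono fun _ hx => hx.1.ne')

theorem IsWeight.ae_iff (hw : IsWeight w) {P : (Fin n → ℝ) → Prop} :
    (∀ᵐ x ∂(weightMeasure w), P x) ↔ ∀ᵐ x, P x :=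
  ⟨fun h => hw.volume_absolutelyContinuous.ae_le h,
    fun h => (weightMeasure_absolutelyContinuous w).ae_le h⟩

theorem IsWeight.aemeasurable_iff (hw : IsWeight w) {f : (Fin n → ℝ) → ℝ≥0∞} :
    AEMeasurable f (weightMeasure w) ↔ AEMeasurable f :=
  ⟨fun h => h.mono_ac hw.volume_absolutelyContinuous,
    fun h => h.mono_ac (weightMeasure_absolutelyContinuous w)⟩

theorem IsWeight.mul (hw : IsWeight w) {k : (Fin n → ℝ) → ℝ≥0∞} (hk : IsWeight k) :
    IsWeight fun x => k x * w x := by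
  refine ⟨hk.1.mul hw.1, ?_⟩
  filter_upwards [hw.2, hk.2] with x h1 h2
  exact ⟨ENNReal.mul_pos h2.1.ne' h1.1.ne', ENNReal.mul_lt_top h2.2 h1.2⟩

theorem IsWeight.rpow (hw : IsWeight w) (t : ℝ) : IsWeight fun x => w x ^ t := by
  refine ⟨hw.1.pow_const t, ?_⟩
  filter_upwards [hw.2] with x h
  exact ⟨ENNReal.rpow_pos h.1 h.2.ne, (ENNReal.rpow_ne_top_of_ne_zero h.1.ne' h.2.ne).lt_top⟩

theorem IsWeight.lintegral_weightMeasure_mul (hw : IsWeight w) {k : (Fin n → ℝ) → ℝ≥0∞}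
    (hk : IsWeight k) (f : (Fin n → ℝ) → ℝ≥0∞) :
    ∫⁻ x, f x ∂(weightMeasure fun x => k x * w x) = ∫⁻ x, f x * k x ∂(weightMeasure w) := by
  rw [(hw.mul hk).lintegral_weightMeasure, hw.lintegral_weightMeasure]
  simp only [mul_assoc]

end Weight

theorem volume_cube_pos {n : ℕ} (c : Fin n → ℝ) {r : ℝ} (hr : 0 < r) : 0 < volume (cube c r) := by
  rw [cube_eq_ball c hr]
  exact Metric.measure_ball_pos _ _ hr

theorem volume_cube_lt_top {n : ℕ} (c : Fin n → ℝ) {r : ℝ} (hr : 0 < r) :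
    volume (cube c r) < ∞ := by
  rw [cube_eq_ball c hr]
  exact measure_ball_lt_top

theorem volume_cube_five_mul {n : ℕ} (c : Fin n → ℝ) {r : ℝ} (hr : 0 < r) :
    volume (cube c (5 * r)) = 5 ^ n * volume (cube c r) := by
  rw [cube_eq_ball c hr, cube_eq_ball c (by positivity), Real.volume_pi_ball _ hr,
    Real.volume_pi_ball _ (by positivity), Fintype.card_fin, show 2 * (5 * r) = 5 * (2 * r) by ring,
    mul_pow, ENNReal.ofReal_mul (by positivity), ENNReal.ofReal_pow (by norm_num)]
  simp

/-! ### Muckenhoupt weights -/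

/-- The `A_p` condition with constant `C`, without the normalisation of the integrals. -/
def ApBound {n : ℕ} (p : ℝ) (w : (Fin n → ℝ) → ℝ≥0∞) (C : ℝ≥0) : Prop :=
  ∀ (c : Fin n → ℝ) (r : ℝ), 0 < r →
    (∫⁻ x in cube c r, w x) * (∫⁻ x in cube c r, w x ^ (-(1 / (p - 1)))) ^ (p - 1) ≤
      C * volume (cube c r) ^ p

section Muckenhoupt

variable {n : ℕ} {w : (Fin n → ℝ) → ℝ≥0∞} {p : ℝ} {C : ℝ≥0}

theorem one_sub_conjExponent (hp : 1 < p) : 1 - p.conjExponent = -(1 / (p - 1)) := by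
  have : p - 1 ≠ 0 := by linarith
  rw [Real.conjExponent]
  field_simp
  ring

theorem div_mul_div_rpow_sub_one {a b m : ℝ≥0∞} (hp : 1 < p) (hm0 : m ≠ 0) (hm : m ≠ ∞) :
    a / m * (b / m) ^ (p - 1) = a * b ^ (p - 1) / m ^ p := by
  have hp1 : 0 ≤ p - 1 := by linarith
  have : m ^ p = m * m ^ (p - 1) := by
    conv_lhs => rw [show p = 1 + (p - 1) by ring]
    rw [ENNReal.rpow_add _ _ hm0 hm, ENNReal.rpow_one]
  rw [ENNReal.div_rpow_of_nonneg _ _ hp1, this, div_eq_mul_inv, div_eq_mul_inv, div_eq_mul_inv,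
    ENNReal.mul_inv (Or.inl hm0) (Or.inl hm)]
  ring

theorem apConst_lt_top_iff (hp : 1 < p) : apConst p w < ∞ ↔ ∃ C : ℝ≥0, ApBound p w C := by
  have key : ∀ (c : Fin n → ℝ) (r : ℝ), 0 < r → ∀ C : ℝ≥0∞,
      (⨍⁻ y in cube c r, w y ∂volume) *
        (⨍⁻ y in cube c r, w y ^ (1 - p.conjExponent) ∂volume) ^ (p - 1) ≤ C ↔
      (∫⁻ x in cube c r, w x) * (∫⁻ x in cube c r, w x ^ (-(1 / (p - 1)))) ^ (p - 1) ≤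
        C * volume (cube c r) ^ p := by
    intro c r hr C
    have h0 := (volume_cube_pos c hr).ne'
    have h1 := (volume_cube_lt_top c hr).ne
    rw [setLAverage_eq, setLAverage_eq, one_sub_conjExponent hp, div_mul_div_rpow_sub_one hp h0 h1,
      ENNReal.div_le_iff (ENNReal.rpow_pos (pos_iff_ne_zero.2 h0) h1).ne'
      (ENNReal.rpow_ne_top_of_ne_zero h0 h1)]
  constructor
  · intro h
    refine ⟨(apConst p w).toNNReal, fun c r hr => ?_⟩
    rw [ENNReal.coe_toNNReal h.ne, ← key c r hr]
    exact le_iSup_of_le c (le_iSup_of_le r (le_iSup_of_le hr le_rfl))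
  · rintro ⟨C, hC⟩
    refine lt_of_le_of_lt ?_ (ENNReal.coe_lt_top (r := C))
    exact iSup_le fun c => iSup_le fun r => iSup_le fun hr => (key c r hr C).2 (hC c r hr)

/-- On the cube, the average of `k` is at most its maximal function, hence at most `a * k`. Thus
`k⁻ᵗ` times the `t`-th power of the average is bounded by `aᵗ` pointwise, and integration gives the
claim. It expresses both `k ∈ A_2(μ)` (`t = 1`) and `k⁻ᵗ ∈ A_{1+t}(μ)`. -/
theorem lintegral_cube_rpow_mul_le {μ : Measure (Fin n → ℝ)} {k : (Fin n → ℝ) → ℝ≥0∞} {a : ℝ≥0∞}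
    (hk : ∀ᵐ x ∂μ, maximalFunction μ k x ≤ a * k x) {t : ℝ} (ht : 0 < t)
    {c : Fin n → ℝ} {r : ℝ} (hr : 0 < r) (h0 : μ (cube c r) ≠ 0) (h1 : μ (cube c r) ≠ ∞) :
    (∫⁻ x in cube c r, k x ^ (-t) ∂μ) * (∫⁻ x in cube c r, k x ∂μ) ^ t ≤
      a ^ t * μ (cube c r) ^ (1 + t) := by
  set m := μ (cube c r)
  set A := ⨍⁻ y in cube c r, k y ∂μ with hA
  have hkA : ∫⁻ x in cube c r, k x ∂μ = A * m := by
    rw [hA, setLAverage_eq, ENNReal.div_mul_cancel h0 h1]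
  have hpt : ∀ᵐ x ∂μ.restrict (cube c r), k x ^ (-t) * A ^ t ≤ a ^ t := by
    filter_upwards [ae_restrict_of_ae hk, ae_restrict_mem (measurableSet_cube c hr)] with x hx hxc
    calc k x ^ (-t) * A ^ t ≤ k x ^ (-t) * (a * k x) ^ t := by
          gcongr
          exact (laverage_le_maximalFunction μ k hr hxc).trans hx
      _ = a ^ t * ((k x ^ t)⁻¹ * k x ^ t) := by
          rw [ENNReal.mul_rpow_of_nonneg _ _ ht.le, ENNReal.rpow_neg]; ring
      _ ≤ a ^ t := mul_le_of_le_one_right' (ENNReal.inv_mul_le_one _)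
  have hAle : (∫⁻ x in cube c r, k x ^ (-t) ∂μ) * A ^ t ≤ a ^ t * m := by
    rw [← setLIntegral_const]
    exact (lintegral_mul_const_le _ _).trans (lintegral_mono_ae hpt)
  rw [hkA, ENNReal.mul_rpow_of_nonneg _ _ ht.le, ← mul_assoc,
    ENNReal.rpow_add_of_nonneg _ _ zero_le_one ht.le, ENNReal.rpow_one, ← mul_assoc]
  gcongr

theorem IsAInfty.exists_apBound (hw : IsAInfty w) : ∃ p : ℝ, 1 < p ∧ ∃ C : ℝ≥0, ApBound p w C := by
  obtain ⟨hww, h | ⟨p, hp, h⟩⟩ := hw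
  · refine ⟨2, one_lt_two, (a1Const w).toNNReal, fun c r hr => ?_⟩
    have hk : ∀ᵐ x, maximalFunction volume w x ≤ a1Const w * w x := by
      filter_upwards [hww.2, ENNReal.ae_le_essSup fun x => hlMaximal w x / w x] with x hx h1
      exact (ENNReal.div_le_iff hx.1.ne' hx.2.ne).1 h1
    have := lintegral_cube_rpow_mul_le hk one_pos hr (volume_cube_pos c hr).ne'
      (volume_cube_lt_top c hr).ne
    rw [ENNReal.coe_toNNReal h.ne, mul_comm]
    norm_num at this ⊢
    exact this
  · exact ⟨p, hp, (apConst_lt_top_iff hp).1 h⟩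

theorem ApBound.isAInfty (h : ApBound p w C) (hw : IsWeight w) (hp : 1 < p) : IsAInfty w :=
  ⟨hw, Or.inr ⟨p, hp, (apConst_lt_top_iff hp).2 ⟨C, h⟩⟩⟩

theorem IsWeight.setLIntegral_rpow_ne_zero (hw : IsWeight w) (t : ℝ) (c : Fin n → ℝ) {r : ℝ}
    (hr : 0 < r) : ∫⁻ x in cube c r, w x ^ t ≠ 0 := by
  intro h
  rw [lintegral_eq_zero_iff' (hw.rpow t).1.restrict] at h
  have : ∀ᵐ x ∂volume.restrict (cube c r), False := by
    filter_upwards [h, ae_restrict_of_ae (hw.rpow t).2] with x h1 h2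
    exact h2.1.ne' h1
  have h3 : volume.restrict (cube c r) = 0 := by simpa using this
  exact (volume_cube_pos c hr).ne' (Measure.restrict_eq_zero.1 h3)

/-- The dual integral is nonzero, so finiteness of the `A_p` product forces finiteness of its first
factor. -/
theorem ApBound.weightMeasure_cube_lt_top (h : ApBound p w C) (hw : IsWeight w) (hp : 1 < p)
    (c : Fin n → ℝ) {r : ℝ} (hr : 0 < r) : weightMeasure w (cube c r) < ∞ := by
  rw [weightMeasure_cube w c hr]
  refine ENNReal.lt_top_of_mul_ne_top_left ((h c r hr).trans_lt ?_).ne ?_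
  · exact ENNReal.mul_lt_top ENNReal.coe_lt_top
      (ENNReal.rpow_lt_top_of_nonneg (by linarith) (volume_cube_lt_top c hr).ne)
  · rw [Ne, ENNReal.rpow_eq_zero_iff_of_pos (by linarith)]
    exact hw.setLIntegral_rpow_ne_zero _ c hr

theorem IsWeight.weightMeasure_cube_ne_zero (hw : IsWeight w) (c : Fin n → ℝ) {r : ℝ}
    (hr : 0 < r) : weightMeasure w (cube c r) ≠ 0 := by
  rw [weightMeasure_cube w c hr]
  simpa using hw.setLIntegral_rpow_ne_zero 1 c hr

theorem IsAInfty.isLocallyFiniteMeasure (hw : IsAInfty w) :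
    IsLocallyFiniteMeasure (weightMeasure w) := by
  obtain ⟨p, hp, C, hC⟩ := hw.exists_apBound
  refine ⟨fun x => ⟨cube x 1, (isOpen_cube x one_pos).mem_nhds (by simp [cube]), ?_⟩⟩
  exact hC.weightMeasure_cube_lt_top hw.1 hp x one_pos

/-- Hölder gives `|Q|^p ≤ w(Q) σ(Q)^{p-1}` with `σ = w^{-1/(p-1)}`. Enlarging `σ(Q)` to `σ(5Q)` and
applying the `A_p` bound on `5Q` compares `w(5Q)` with `w(Q)`. -/
theorem IsAInfty.exists_doubling (hw : IsAInfty w) :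
    ∃ D : ℝ≥0, ∀ (c : Fin n → ℝ) (r : ℝ), 0 < r →
      weightMeasure w (cube c (5 * r)) ≤ D * weightMeasure w (cube c r) := by
  obtain ⟨p, hp, C, hC⟩ := hw.exists_apBound
  have hp0 : 0 < p := by linarith
  have hp1 : 0 < p - 1 := by linarith
  refine ⟨C * (5 ^ n) ^ p, fun c r hr => ?_⟩
  have hr5 : 0 < 5 * r := by positivity
  have hsub : cube c r ⊆ cube c (5 * r) := fun y hy i => (hy i).trans (by linarith)
  set V := volume (cube c r)
  have hV0 : V ^ p ≠ 0 := (ENNReal.rpow_pos (volume_cube_pos c hr) (volume_cube_lt_top c hr).ne).ne'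
  have hV1 : V ^ p ≠ ∞ := ENNReal.rpow_ne_top_of_nonneg hp0.le (volume_cube_lt_top c hr).ne
  have hholder : V ^ p ≤ (∫⁻ x in cube c r, w x) *
      (∫⁻ x in cube c r, w x ^ (-(1 / (p - 1)))) ^ (p - 1) := by
    have h1 : V ≤ (∫⁻ x in cube c r, w x) ^ (1 / p) *
        (∫⁻ x in cube c r, w x ^ (-(1 / (p - 1)))) ^ ((p - 1) / p) := by
      refine le_trans (le_of_eq ?_) (ENNReal.lintegral_mul_norm_pow_le hw.1.1.restrict
        (hw.1.rpow _).1.restrict (by positivity) (by positivity) (by field_simp; ring))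
      rw [show V = ∫⁻ _ in cube c r, 1 from (setLIntegral_one _).symm]
      refine lintegral_congr_ae ?_
      filter_upwards [ae_restrict_of_ae hw.1.2] with x hx
      rw [← ENNReal.rpow_mul, ← ENNReal.rpow_add _ _ hx.1.ne' hx.2.ne]
      rw [show 1 / p + -(1 / (p - 1)) * ((p - 1) / p) = 0 by field_simp; ring, ENNReal.rpow_zero]
    refine (ENNReal.rpow_le_rpow h1 hp0.le).trans_eq ?_
    rw [ENNReal.mul_rpow_of_nonneg _ _ hp0.le, ← ENNReal.rpow_mul, ← ENNReal.rpow_mul,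
      one_div_mul_cancel hp0.ne', div_mul_cancel₀ _ hp0.ne', ENNReal.rpow_one]
  rw [← ENNReal.mul_le_mul_iff_left hV0 hV1]
  calc weightMeasure w (cube c (5 * r)) * V ^ p
      ≤ weightMeasure w (cube c (5 * r)) * ((∫⁻ x in cube c r, w x) *
          (∫⁻ x in cube c (5 * r), w x ^ (-(1 / (p - 1)))) ^ (p - 1)) := by
        gcongr
        exact hholder.trans (by gcongr)
    _ = weightMeasure w (cube c r) * ((∫⁻ x in cube c (5 * r), w x) *
          (∫⁻ x in cube c (5 * r), w x ^ (-(1 / (p - 1)))) ^ (p - 1)) := by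
        rw [weightMeasure_cube w c hr, weightMeasure_cube w c hr5]
        ring
    _ ≤ weightMeasure w (cube c r) * (C * volume (cube c (5 * r)) ^ p) := by
        exact mul_le_mul_right (hC c _ hr5) _
    _ = _ := by
        rw [volume_cube_five_mul c hr, ENNReal.mul_rpow_of_nonneg _ _ hp0.le, ENNReal.coe_mul,
          ENNReal.coe_rpow_of_nonneg _ hp0.le]
        push_cast
        ring

/-- If `w ∈ A_p` and `k ∈ A_q(w dx)`, then `k w ∈ A_{pq}`. -/
theorem ApBound.mul (hC : ApBound p w C) (hp : 1 < p) (hw : IsWeight w)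
    {k : (Fin n → ℝ) → ℝ≥0∞} (hk : IsWeight k) {q : ℝ} (hq : 1 < q) {C' : ℝ≥0}
    (hkC : ∀ (c : Fin n → ℝ) (r : ℝ), 0 < r →
      (∫⁻ x in cube c r, k x ∂(weightMeasure w)) *
        (∫⁻ x in cube c r, k x ^ (-(1 / (q - 1))) ∂(weightMeasure w)) ^ (q - 1) ≤
      C' * weightMeasure w (cube c r) ^ q) :
    ApBound (p * q) (fun x => k x * w x) (C' * C ^ q) := by
  intro c r hr
  have hpq : 1 < p * q := by nlinarith
  have hp1 : 0 < p - 1 := by linarith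
  have hq1 : 0 < q - 1 := by linarith
  have hpq1 : 0 < p * q - 1 := by linarith
  have hQ := measurableSet_cube c hr
  -- The two exponents sum to 1, and they are the ones for which the powers of `k` and of `w` on the
  -- right multiply to those on the left.
  have hholder : ∫⁻ x in cube c r, (k x * w x) ^ (-(1 / (p * q - 1))) ≤
      (∫⁻ x in cube c r, k x ^ (-(1 / (q - 1))) * w x) ^ ((q - 1) / (p * q - 1)) *
        (∫⁻ x in cube c r, w x ^ (-(1 / (p - 1)))) ^ (q * (p - 1) / (p * q - 1)) := by
    refine le_trans (le_of_eq ?_) (ENNReal.lintegral_mul_norm_pow_le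
      ((hk.rpow _).1.mul hw.1).restrict (hw.rpow _).1.restrict (by positivity) (by positivity)
      (by rw [← add_div, div_eq_one_iff_eq hpq1.ne']; ring))
    refine lintegral_congr_ae ?_
    filter_upwards [ae_restrict_of_ae hw.2, ae_restrict_of_ae hk.2] with x hx hkx
    rw [Pi.mul_apply, ENNReal.mul_rpow_of_ne_zero hkx.1.ne' hx.1.ne',
      ENNReal.mul_rpow_of_nonneg _ _ (by positivity), ← ENNReal.rpow_mul, ← ENNReal.rpow_mul,
      mul_assoc, ← ENNReal.rpow_add _ _ hx.1.ne' hx.2.ne]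
    congr 2
    · field_simp
    · field_simp
      ring
  calc (∫⁻ x in cube c r, k x * w x) *
        (∫⁻ x in cube c r, (k x * w x) ^ (-(1 / (p * q - 1)))) ^ (p * q - 1)
      ≤ (∫⁻ x in cube c r, k x * w x) *
        ((∫⁻ x in cube c r, k x ^ (-(1 / (q - 1))) * w x) ^ ((q - 1) / (p * q - 1)) *
        (∫⁻ x in cube c r, w x ^ (-(1 / (p - 1)))) ^ (q * (p - 1) / (p * q - 1))) ^
          (p * q - 1) := by
        gcongr
    _ = (∫⁻ x in cube c r, k x * w x) *
        (∫⁻ x in cube c r, k x ^ (-(1 / (q - 1))) * w x) ^ (q - 1) *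
        ((∫⁻ x in cube c r, w x ^ (-(1 / (p - 1)))) ^ (p - 1)) ^ q := by
        rw [ENNReal.mul_rpow_of_nonneg _ _ hpq1.le, ← ENNReal.rpow_mul, ← ENNReal.rpow_mul,
          div_mul_cancel₀ _ hpq1.ne', div_mul_cancel₀ _ hpq1.ne', ← ENNReal.rpow_mul,
          mul_comm q (p - 1), mul_assoc]
    _ ≤ C' * weightMeasure w (cube c r) ^ q *
        ((∫⁻ x in cube c r, w x ^ (-(1 / (p - 1)))) ^ (p - 1)) ^ q := by
        have := hkC c r hr
        rw [hw.setLIntegral_weightMeasure _ hQ, hw.setLIntegral_weightMeasure _ hQ] at this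
        exact mul_le_mul_left this _
    _ = C' * ((∫⁻ x in cube c r, w x) *
        (∫⁻ x in cube c r, w x ^ (-(1 / (p - 1)))) ^ (p - 1)) ^ q := by
        rw [weightMeasure_cube w c hr, ENNReal.mul_rpow_of_nonneg _ _ (by linarith), mul_assoc]
    _ ≤ C' * (C * volume (cube c r) ^ p) ^ q := by
        exact mul_le_mul_right (ENNReal.rpow_le_rpow (hC c r hr) (by linarith)) _
    _ = _ := by
        rw [ENNReal.mul_rpow_of_nonneg _ _ (by linarith), ← ENNReal.rpow_mul, ENNReal.coe_mul,
          ENNReal.coe_rpow_of_nonneg _ (by linarith), mul_assoc]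

/-- `A_1(w dx)` weights multiply `A_∞` into itself. -/
theorem IsAInfty.mul_of_maximalFunction_le (hw : IsAInfty w) {k : (Fin n → ℝ) → ℝ≥0∞}
    (hk : IsWeight k) {a : ℝ≥0}
    (hM : ∀ x, maximalFunction (weightMeasure w) k x ≤ a * k x) :
    IsAInfty fun x => k x * w x := by
  obtain ⟨p, hp, C, hC⟩ := hw.exists_apBound
  refine (hC.mul hp hw.1 hk one_lt_two (C' := a) fun c r hr => ?_).isAInfty (hw.1.mul hk)
    (by linarith)
  have := lintegral_cube_rpow_mul_le (ae_of_all _ hM) one_pos hr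
    (hw.1.weightMeasure_cube_ne_zero c hr) (hC.weightMeasure_cube_lt_top hw.1 hp c hr).ne
  rw [mul_comm]
  norm_num at this ⊢
  exact this

/-- Negative powers of `A_1(w dx)` weights multiply `A_∞` into itself. -/
theorem IsAInfty.rpow_neg_mul_of_maximalFunction_le (hw : IsAInfty w)
    {k : (Fin n → ℝ) → ℝ≥0∞} (hk : IsWeight k) {a : ℝ≥0}
    (hM : ∀ x, maximalFunction (weightMeasure w) k x ≤ a * k x) {t : ℝ} (ht : 0 < t) :
    IsAInfty fun x => k x ^ (-t) * w x := by
  obtain ⟨p, hp, C, hC⟩ := hw.exists_apBound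
  -- With `q = 1 + t` the dual power of `k⁻ᵗ` is `k` itself.
  refine (hC.mul hp hw.1 (hk.rpow (-t)) (q := 1 + t) (by linarith) (C' := a ^ t)
    fun c r hr => ?_).isAInfty (hw.1.mul (hk.rpow _)) (by nlinarith)
  have := lintegral_cube_rpow_mul_le (ae_of_all _ hM) ht hr
    (hw.1.weightMeasure_cube_ne_zero c hr) (hC.weightMeasure_cube_lt_top hw.1 hp c hr).ne
  simp only [← ENNReal.rpow_mul]
  rw [ENNReal.coe_rpow_of_nonneg _ ht.le, add_sub_cancel_left,
    show -t * -(1 / t) = 1 by field_simp]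
  simpa using this

theorem IsAInfty.exists_lintegral_maximalFunction_rpow_le (hw : IsAInfty w) {s : ℝ} (hs : 1 < s) :
    ∃ C : ℝ≥0, ∀ f : (Fin n → ℝ) → ℝ≥0∞, AEMeasurable f (weightMeasure w) →
      ∫⁻ x, maximalFunction (weightMeasure w) f x ^ s ∂(weightMeasure w) ≤
        C * ∫⁻ x, f x ^ s ∂(weightMeasure w) := by
  have := hw.isLocallyFiniteMeasure
  obtain ⟨D, hD⟩ := hw.exists_doubling
  exact _root_.exists_lintegral_maximalFunction_rpow_le hD hs

end Muckenhoupt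

/-! ### Truncations -/

section Truncation

variable {α : Type*} [MeasurableSpace α] (μ : Measure α) [SigmaFinite μ]

/-- Truncation of `f` in height and to sets of finite measure. -/
noncomputable def truncate (f : α → ℝ≥0∞) (k : ℕ) : α → ℝ≥0∞ :=
  (spanningSets μ k).indicator fun x => min (f x) k

variable {μ} {f : α → ℝ≥0∞}

theorem aemeasurable_truncate (hf : AEMeasurable f μ) (k : ℕ) : AEMeasurable (truncate μ f k) μ :=
  (hf.min aemeasurable_const).indicator (measurableSet_spanningSets μ k)

theorem truncate_le_natCast (k : ℕ) (x : α) : truncate μ f k x ≤ k :=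
  Set.indicator_le' (fun _ _ => min_le_right _ _) (fun _ _ => zero_le) x

theorem truncate_lt_top (k : ℕ) (x : α) : truncate μ f k x < ∞ :=
  (truncate_le_natCast k x).trans_lt (ENNReal.natCast_lt_top k)

theorem truncate_le (k : ℕ) (x : α) : truncate μ f k x ≤ f x :=
  Set.indicator_le' (fun _ _ => min_le_left _ _) (fun _ _ => zero_le) x

theorem monotone_truncate (x : α) : Monotone fun k => truncate μ f k x := by
  intro j k hjk
  have h1 : min (f x) (j : ℝ≥0∞) ≤ min (f x) (k : ℝ≥0∞) :=
    min_le_min_left _ (by exact_mod_cast hjk)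
  refine (Set.indicator_le_indicator_of_subset (monotone_spanningSets μ hjk)
    (fun _ => zero_le) x).trans (Set.indicator_le_indicator h1)

theorem tendsto_truncate (x : α) : Tendsto (fun k => truncate μ f k x) atTop (𝓝 (f x)) := by
  have hmin : Tendsto (fun k : ℕ => min (f x) (k : ℝ≥0∞)) atTop (𝓝 (min (f x) ∞)) :=
    (tendsto_const_nhds (x := f x)).min ENNReal.tendsto_nat_nhds_top
  rw [min_eq_left le_top] at hmin
  refine hmin.congr' ?_
  filter_upwards [eventually_mem_spanningSets μ x] with k hk
  exact (Set.indicator_of_mem hk fun y => min (f y) (k : ℝ≥0∞)).symm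

theorem lintegral_truncate_rpow_lt_top {s : ℝ} (hs : 0 < s) (k : ℕ) :
    ∫⁻ x, truncate μ f k x ^ s ∂μ < ∞ := by
  calc ∫⁻ x, truncate μ f k x ^ s ∂μ
      ≤ ∫⁻ x, (spanningSets μ k).indicator (fun _ => (k : ℝ≥0∞) ^ s) x ∂μ := by
        refine lintegral_mono fun x => ?_
        by_cases hx : x ∈ spanningSets μ k
        · rw [Set.indicator_of_mem hx]
          exact ENNReal.rpow_le_rpow (truncate_le_natCast k x) hs.le
        · simp [truncate, hx, hs]
    _ < ∞ := by
        rw [lintegral_indicator_const (measurableSet_spanningSets μ k)]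
        exact ENNReal.mul_lt_top (ENNReal.rpow_lt_top_of_nonneg hs.le (ENNReal.natCast_ne_top k))
          (measure_spanningSets_lt_top μ k)

theorem memLp_two_toReal_truncate (hf : AEMeasurable f μ) (k : ℕ) :
    MemLp (fun x => (truncate μ f k x).toReal) 2 μ := by
  refine ⟨(aemeasurable_truncate hf k).ennreal_toReal.aestronglyMeasurable, ?_⟩
  rw [eLpNorm_lt_top_iff_lintegral_rpow_enorm_lt_top two_ne_zero ENNReal.ofNat_ne_top]
  have h := lintegral_truncate_rpow_lt_top (μ := μ) (f := f) two_pos k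
  refine lt_of_eq_of_lt (lintegral_congr fun x => ?_) h
  rw [Real.enorm_of_nonneg ENNReal.toReal_nonneg, ENNReal.ofReal_toReal (truncate_lt_top k x).ne]
  simp

theorem tendsto_lintegral_truncate_mul (hf : AEMeasurable f μ) {h : α → ℝ≥0∞}
    (hh : AEMeasurable h μ) :
    Tendsto (fun k => ∫⁻ x, h x * truncate μ f k x ∂μ) atTop (𝓝 (∫⁻ x, h x * f x ∂μ)) := by
  have h1 : ∀ k, AEMeasurable (fun x => truncate μ f k x) (μ.withDensity h) := fun k =>
    (aemeasurable_truncate hf k).mono_ac (withDensity_absolutelyContinuous _ _)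
  have key := lintegral_tendsto_of_tendsto_of_monotone h1
    (ae_of_all _ fun x => monotone_truncate x) (ae_of_all _ fun x => tendsto_truncate x)
  rw [lintegral_withDensity_eq_lintegral_mul₀ hh hf] at key
  simpa only [lintegral_withDensity_eq_lintegral_mul₀ hh (aemeasurable_truncate hf _),
    Pi.mul_apply] using key

end Truncation

/-! ### The Lorentz–Luxemburg theorem -/

namespace BanachFunctionSpace

variable {α : Type*} [MeasurableSpace α] {μ : Measure α} (X : BanachFunctionSpace μ)

theorem norm_congr {f g : α → ℝ≥0∞} (hf : AEMeasurable f μ) (hg : AEMeasurable g μ)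
    (h : f =ᵐ[μ] g) : X.norm f = X.norm g :=
  le_antisymm (X.norm_mono f g hf hg h.le) (X.norm_mono g f hg hf h.symm.le)

/-- Fatou's lemma in `X`: the infima over tails increase to the limit. -/
theorem norm_le_one_of_tendsto {f : ℕ → α → ℝ≥0∞} {g : α → ℝ≥0∞}
    (hf : ∀ j, AEMeasurable (f j) μ) (hg : AEMeasurable g μ)
    (hlim : ∀ᵐ x ∂μ, Tendsto (fun j => f j x) atTop (𝓝 (g x))) (h1 : ∀ j, X.norm (f j) ≤ 1) :
    X.norm g ≤ 1 := by
  have hm : ∀ k, AEMeasurable (fun x => ⨅ j : ℕ, f (j + k) x) μ := fun k =>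
    AEMeasurable.iInf fun j => hf (j + k)
  refine le_of_tendsto (X.norm_fatou (fun k x => ⨅ j : ℕ, f (j + k) x) g hm hg ?_ ?_)
    (Eventually.of_forall fun k => (X.norm_mono _ _ (hm k) (hf k) ?_).trans (h1 k))
  · refine ae_of_all _ fun x k l hkl => le_iInf fun j => ?_
    refine (iInf_le _ (j + (l - k))).trans_eq ?_
    rw [show j + (l - k) + k = j + l by omega]
  · filter_upwards [hlim] with x hx
    have h2 := tendsto_atTop_iSup (f := fun k => ⨅ j : ℕ, f (j + k) x) fun k l hkl =>
      le_iInf fun j => (iInf_le _ (j + (l - k))).trans_eq (by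
        rw [show j + (l - k) + k = j + l by omega])
    have h3 := hx.liminf_eq
    rw [liminf_eq_iSup_iInf_of_nat'] at h3
    rwa [h3] at h2
  · exact ae_of_all _ fun x => (iInf_le _ 0).trans_eq (by rw [zero_add])

/-- The part of the unit ball of `X` that lies in `L²`. -/
def ballL2 : Set (Lp ℝ 2 μ) :=
  {φ | X.norm (fun x => ‖φ x‖ₑ) ≤ 1}

theorem aemeasurable_enorm_Lp (φ : Lp ℝ 2 μ) : AEMeasurable (fun x => ‖φ x‖ₑ) μ :=
  (Lp.aestronglyMeasurable φ).enorm

theorem convex_ballL2 : Convex ℝ X.ballL2 := by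
  intro φ hφ ψ hψ a b ha hb hab
  have hm : ∀ (c : ℝ≥0) (φ : Lp ℝ 2 μ), AEMeasurable (fun x => (c : ℝ≥0∞) * ‖φ x‖ₑ) μ :=
    fun c φ => (aemeasurable_enorm_Lp φ).const_mul _
  lift a to ℝ≥0 using ha
  lift b to ℝ≥0 using hb
  have hφ : X.norm (fun x => ‖φ x‖ₑ) ≤ 1 := hφ
  have hψ : X.norm (fun x => ‖ψ x‖ₑ) ≤ 1 := hψ
  have hab' : (a : ℝ≥0∞) + b = 1 := by exact_mod_cast hab
  change X.norm _ ≤ 1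
  calc X.norm (fun x => ‖((a : ℝ) • φ + (b : ℝ) • ψ : Lp ℝ 2 μ) x‖ₑ)
      ≤ X.norm (fun x => (a : ℝ≥0∞) * ‖φ x‖ₑ + (b : ℝ≥0∞) * ‖ψ x‖ₑ) := by
        refine X.norm_mono _ _ (aemeasurable_enorm_Lp _) ((hm a φ).add (hm b ψ)) ?_
        filter_upwards [Lp.coeFn_add ((a : ℝ) • φ) ((b : ℝ) • ψ), Lp.coeFn_smul (a : ℝ) φ,
          Lp.coeFn_smul (b : ℝ) ψ] with x h1 h2 h3
        rw [h1, Pi.add_apply, h2, h3, Pi.smul_apply, Pi.smul_apply]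
        refine (enorm_add_le _ _).trans_eq ?_
        rw [enorm_smul, enorm_smul]
        simp
    _ ≤ a * X.norm (fun x => ‖φ x‖ₑ) + b * X.norm (fun x => ‖ψ x‖ₑ) := by
        refine (X.norm_add_le _ _ (hm a φ) (hm b ψ)).trans_eq ?_
        rw [X.norm_smul a _ (aemeasurable_enorm_Lp φ), X.norm_smul b _ (aemeasurable_enorm_Lp ψ)]
    _ ≤ a * 1 + b * 1 := by gcongr
    _ = 1 := by rw [mul_one, mul_one, hab']

/-- An `L²` limit is an a.e. limit along a subsequence, so the Fatou property keeps it in the ball.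
-/
theorem isClosed_ballL2 : IsClosed X.ballL2 := by
  refine IsSeqClosed.isClosed fun φ ψ hφ hlim => ?_
  obtain ⟨ns, -, hns⟩ :=
    (tendstoInMeasure_of_tendsto_Lp hlim).exists_seq_tendsto_ae
  refine X.norm_le_one_of_tendsto (f := fun j x => ‖φ (ns j) x‖ₑ)
    (fun j => aemeasurable_enorm_Lp _) (aemeasurable_enorm_Lp _) ?_ (fun j => hφ (ns j))
  filter_upwards [hns] with x hx
  exact hx.enorm

theorem zero_mem_ballL2 : (0 : Lp ℝ 2 μ) ∈ X.ballL2 := by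
  have : X.norm (fun x => ‖(0 : Lp ℝ 2 μ) x‖ₑ) = 0 := by
    rw [X.norm_eq_zero_iff _ (aemeasurable_enorm_Lp _)]
    filter_upwards [Lp.coeFn_zero ℝ 2 μ] with x hx
    rw [hx, Pi.zero_apply, enorm_zero, Pi.zero_apply]
  exact this.le.trans zero_le_one

theorem toLp_mem_ballL2 {φ : α → ℝ} (hφ : MemLp φ 2 μ) {f : α → ℝ≥0∞} (hf : AEMeasurable f μ)
    (h : ∀ x, ‖φ x‖ₑ = f x) : hφ.toLp φ ∈ X.ballL2 ↔ X.norm f ≤ 1 := by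
  have : X.norm (fun x => ‖hφ.toLp φ x‖ₑ) = X.norm f := by
    refine X.norm_congr (aemeasurable_enorm_Lp _) hf ?_
    filter_upwards [hφ.coeFn_toLp] with x hx
    rw [hx, h x]
  rw [← this]
  rfl

theorem inner_toLp_eq (g : Lp ℝ 2 μ) {φ : α → ℝ} (hφ : MemLp φ 2 μ) :
    inner ℝ g (hφ.toLp φ) = ∫ x, g x * φ x ∂μ := by
  rw [L2.inner_def]
  refine integral_congr_ae ?_
  filter_upwards [hφ.coeFn_toLp] with x hx
  rw [hx, real_inner_eq_re_inner, RCLike.inner_apply]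
  simp [mul_comm]

/-- Hahn–Banach separates `f` from the closed convex set `ballL2` at a level `γ`, and Riesz
represents the functional by some `g ∈ L²`. The witness is `|g| / γ`. -/
theorem exists_one_lt_lintegral_mul [SigmaFinite μ] {f : α → ℝ≥0∞} (hf : AEMeasurable f μ)
    (hf2 : MemLp (fun x => (f x).toReal) 2 μ) (hfin : ∀ x, f x < ∞) (h1 : 1 < X.norm f) :
    ∃ h : α → ℝ≥0∞, AEMeasurable h μ ∧ X.associateNorm h ≤ 1 ∧ 1 < ∫⁻ x, f x * h x ∂μ := by
  have henorm : ∀ x, ‖(f x).toReal‖ₑ = f x := fun x => by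
    rw [Real.enorm_of_nonneg ENNReal.toReal_nonneg, ENNReal.ofReal_toReal (hfin x).ne]
  have hnot : hf2.toLp _ ∉ X.ballL2 := by
    rw [X.toLp_mem_ballL2 hf2 hf henorm]
    exact not_le.2 h1
  obtain ⟨ℓ, γ, hγU, hγf⟩ :=
    geometric_hahn_banach_closed_point X.convex_ballL2 X.isClosed_ballL2 hnot
  set g : Lp ℝ 2 μ := (InnerProductSpace.toDual ℝ (Lp ℝ 2 μ)).symm ℓ with hg
  have hℓ : ∀ {φ : α → ℝ} (hφ : MemLp φ 2 μ), ℓ (hφ.toLp φ) = ∫ x, g x * φ x ∂μ := by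
    intro φ hφ
    rw [← inner_toLp_eq, hg, InnerProductSpace.toDual_symm_apply]
  have hγ : 0 < γ := by simpa using hγU 0 X.zero_mem_ballL2
  have hγ0 : ENNReal.ofReal γ ≠ 0 := by simpa using hγ
  have hgm : AEMeasurable (fun x => ‖g x‖ₑ) μ := aemeasurable_enorm_Lp g
  refine ⟨fun x => (ENNReal.ofReal γ)⁻¹ * ‖g x‖ₑ, hgm.const_mul _, ?_, ?_⟩
  · refine iSup_le fun φ => iSup_le fun hφ => iSup_le fun hφ1 => ?_
    have hγi : (ENNReal.ofReal γ)⁻¹ ≠ ∞ := ENNReal.inv_ne_top.2 hγ0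
    simp only [mul_assoc]
    rw [lintegral_const_mul' _ _ hγi, mul_comm, ← div_eq_mul_inv,
      ENNReal.div_le_iff hγ0 ENNReal.ofReal_ne_top, one_mul]
    refine le_of_tendsto (tendsto_lintegral_truncate_mul hφ hgm) (Eventually.of_forall fun k => ?_)
    -- Giving the truncation the sign of `g` leaves its modulus, hence its norm, unchanged, and
    -- makes `g * ψ` nonnegative.
    set ψ : α → ℝ := fun x => (if 0 ≤ g x then 1 else -1) * (truncate μ φ k x).toReal with hψ
    have hψe : ∀ x, ‖ψ x‖ₑ = truncate μ φ k x := by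
      intro x
      rw [hψ]
      simp only [enorm_mul]
      rw [Real.enorm_of_nonneg ENNReal.toReal_nonneg,
        ENNReal.ofReal_toReal (truncate_lt_top k x).ne]
      split_ifs <;> simp
    have hψm : AEStronglyMeasurable ψ μ := by
      refine AEMeasurable.aestronglyMeasurable ?_
      refine AEMeasurable.mul ?_ (aemeasurable_truncate hφ k).ennreal_toReal
      have hs : Measurable fun y : ℝ => if 0 ≤ y then (1 : ℝ) else -1 :=
        Measurable.ite measurableSet_Ici measurable_const measurable_const
      exact hs.comp_aemeasurable (Lp.aestronglyMeasurable g).aemeasurable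
    have hψ2 : MemLp ψ 2 μ := by
      refine (memLp_two_toReal_truncate hφ k).mono hψm (ae_of_all _ fun x => le_of_eq ?_)
      rw [← toReal_enorm, ← toReal_enorm, hψe, Real.enorm_of_nonneg ENNReal.toReal_nonneg,
        ENNReal.ofReal_toReal (truncate_lt_top k x).ne]
    have hmem : hψ2.toLp ψ ∈ X.ballL2 :=
      (X.toLp_mem_ballL2 hψ2 (aemeasurable_truncate hφ k) hψe).2
        ((X.norm_mono _ _ (aemeasurable_truncate hφ k) hφ
          (ae_of_all _ fun x => truncate_le k x)).trans hφ1)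
    have hlt := hγU _ hmem
    rw [hℓ hψ2] at hlt
    have hnn : ∀ x, 0 ≤ g x * ψ x := by
      intro x
      rw [hψ]
      by_cases hx : 0 ≤ g x
      · simp only [hx, if_true, one_mul]
        positivity
      · simp only [hx, if_false]
        exact mul_nonneg_of_nonpos_of_nonpos (not_le.1 hx).le
          (mul_nonpos_of_nonpos_of_nonneg (by norm_num) ENNReal.toReal_nonneg)
    have hint : Integrable (fun x => g x * ψ x) μ :=
      (Lp.memLp g).integrable_mul hψ2
    have : ∫⁻ x, ‖g x‖ₑ * truncate μ φ k x ∂μ = ENNReal.ofReal (∫ x, g x * ψ x ∂μ) := by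
      rw [ofReal_integral_eq_lintegral_ofReal hint (ae_of_all _ hnn)]
      refine lintegral_congr fun x => ?_
      rw [← Real.enorm_of_nonneg (hnn x), enorm_mul, hψe]
    rw [this]
    exact ENNReal.ofReal_le_ofReal hlt.le
  · have h2 : ENNReal.ofReal γ < ∫⁻ x, ‖g x‖ₑ * f x ∂μ := by
      rw [hℓ hf2] at hγf
      calc ENNReal.ofReal γ < ENNReal.ofReal (∫ x, g x * (f x).toReal ∂μ) :=
            (ENNReal.ofReal_lt_ofReal_iff (hγ.trans hγf)).2 hγf
        _ ≤ ‖∫ x, g x * (f x).toReal ∂μ‖ₑ := by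
            rw [Real.enorm_eq_ofReal_abs]
            exact ENNReal.ofReal_le_ofReal (le_abs_self _)
        _ ≤ ∫⁻ x, ‖g x * (f x).toReal‖ₑ ∂μ := enorm_integral_le_lintegral_enorm _
        _ = _ := by simp only [enorm_mul, henorm]
    have h3 : ∫⁻ x, f x * ((ENNReal.ofReal γ)⁻¹ * ‖g x‖ₑ) ∂μ =
        (∫⁻ x, ‖g x‖ₑ * f x ∂μ) / ENNReal.ofReal γ := by
      rw [ENNReal.div_eq_inv_mul, ← lintegral_const_mul' _ _ (ENNReal.inv_ne_top.2 hγ0)]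
      exact lintegral_congr fun x => by ring
    rw [h3, ENNReal.lt_div_iff_mul_lt (Or.inl hγ0) (Or.inl ENNReal.ofReal_ne_top), one_mul]
    exact h2

/-- The norm of a Banach function space is dominated by its second associate norm. -/
theorem norm_le_of_forall_lintegral_mul_le [SigmaFinite μ] {f : α → ℝ≥0∞} (hf : AEMeasurable f μ)
    {A : ℝ≥0∞} (hA : ∀ h, AEMeasurable h μ → X.associateNorm h ≤ 1 → ∫⁻ x, f x * h x ∂μ ≤ A) :
    X.norm f ≤ A := by
  by_contra hlt
  -- The gap leaves room for truncation: by the Fatou property some truncation of `f`, which is in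
  -- `L²`, still has norm above `a`.
  obtain ⟨a, hAa, haf⟩ := ENNReal.lt_iff_exists_nnreal_btwn.1 (not_le.1 hlt)
  have ha : 0 < a := ENNReal.coe_pos.1 (zero_le.trans_lt hAa)
  have hlim := X.norm_fatou (truncate μ f) f (aemeasurable_truncate hf) hf
    (ae_of_all _ monotone_truncate) (ae_of_all _ tendsto_truncate)
  obtain ⟨k, hk⟩ := (hlim.eventually (lt_mem_nhds haf)).exists
  have ha0 : (a : ℝ≥0∞) ≠ 0 := ENNReal.coe_ne_zero.2 ha.ne'
  obtain ⟨h, hh, hh1, hlt1⟩ := X.exists_one_lt_lintegral_mul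
    (f := fun x => ((a⁻¹ : ℝ≥0) : ℝ≥0∞) * truncate μ f k x)
    ((aemeasurable_truncate hf k).const_mul _)
    (by simpa using (memLp_two_toReal_truncate hf k).const_mul ((a⁻¹ : ℝ≥0) : ℝ))
    (fun x => ENNReal.mul_lt_top ENNReal.coe_lt_top (truncate_lt_top k x))
    (by
      rw [X.norm_smul _ _ (aemeasurable_truncate hf k), ENNReal.coe_inv ha.ne', mul_comm,
        ← div_eq_mul_inv, ENNReal.lt_div_iff_mul_lt (Or.inl ha0) (Or.inl ENNReal.coe_ne_top),
        one_mul]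
      exact hk)
  refine absurd hlt1 (not_lt.2 ?_)
  calc ∫⁻ x, ((a⁻¹ : ℝ≥0) : ℝ≥0∞) * truncate μ f k x * h x ∂μ
      ≤ ∫⁻ x, ((a⁻¹ : ℝ≥0) : ℝ≥0∞) * (f x * h x) ∂μ := by
        refine lintegral_mono fun x => ?_
        rw [mul_assoc]
        gcongr
        exact truncate_le k x
    _ = ((a⁻¹ : ℝ≥0) : ℝ≥0∞) * ∫⁻ x, f x * h x ∂μ := lintegral_const_mul' _ _ ENNReal.coe_ne_top
    _ ≤ (a : ℝ≥0∞)⁻¹ * a := by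
        rw [ENNReal.coe_inv ha.ne']
        gcongr
        exact (hA h hh hh1).trans hAa.le
    _ ≤ 1 := ENNReal.inv_mul_le_one _

theorem lintegral_mul_le_associateNorm {f g : α → ℝ≥0∞} (hg : AEMeasurable g μ)
    (hg1 : X.norm g ≤ 1) : ∫⁻ x, f x * g x ∂μ ≤ X.associateNorm f :=
  le_iSup_of_le g (le_iSup_of_le hg (le_iSup_of_le hg1 le_rfl))

/-- Hölder's inequality for a Banach function space and its associate. -/
theorem lintegral_mul_le {f g : α → ℝ≥0∞} (hg : AEMeasurable g μ)
    (hf1 : X.associateNorm f ≤ 1) : ∫⁻ x, g x * f x ∂μ ≤ X.norm g := by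
  rcases eq_or_ne (X.norm g) ∞ with h | hfin
  · rw [h]
    exact le_top
  have hpos : ∀ a : ℝ≥0, X.norm g < a → ∫⁻ x, g x * f x ∂μ ≤ a := by
    intro a hga
    have ha : a ≠ 0 := by
      rintro rfl
      simp at hga
    have h1 : X.norm (fun x => ((a⁻¹ : ℝ≥0) : ℝ≥0∞) * g x) ≤ 1 := by
      rw [X.norm_smul _ _ hg, ENNReal.coe_inv ha]
      refine le_trans ?_ (ENNReal.inv_mul_le_one (a : ℝ≥0∞))
      gcongr
    have h2 := (X.lintegral_mul_le_associateNorm (f := f) (hg.const_mul _) h1).trans hf1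
    have h3 : ∫⁻ x, f x * (((a⁻¹ : ℝ≥0) : ℝ≥0∞) * g x) ∂μ =
        ((a⁻¹ : ℝ≥0) : ℝ≥0∞) * ∫⁻ x, g x * f x ∂μ := by
      rw [← lintegral_const_mul' _ _ ENNReal.coe_ne_top]
      exact lintegral_congr fun x => by ring
    rw [h3, ENNReal.coe_inv ha, mul_comm, ← div_eq_mul_inv,
      ENNReal.div_le_iff (ENNReal.coe_ne_zero.2 ha) ENNReal.coe_ne_top, one_mul] at h2
    exact h2
  refine le_of_forall_gt fun b hb => ?_
  obtain ⟨a, h1, h2⟩ := ENNReal.lt_iff_exists_nnreal_btwn.1 hb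
  exact (hpos a h1).trans_lt h2

theorem associateNorm_tsum_le {h : ℕ → α → ℝ≥0∞} (hh : ∀ k, AEMeasurable (h k) μ) :
    X.associateNorm (fun x => ∑' k, h k x) ≤ ∑' k, X.associateNorm (h k) := by
  refine iSup_le fun g => iSup_le fun hg => iSup_le fun hg1 => ?_
  simp only [← ENNReal.tsum_mul_right]
  rw [lintegral_tsum (f := fun k x => h k x * g x) fun k => (hh k).mul hg]
  exact ENNReal.tsum_le_tsum fun k => X.lintegral_mul_le_associateNorm hg hg1

theorem associateNorm_const_mul_le (a : ℝ≥0) (h : α → ℝ≥0∞) :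
    X.associateNorm (fun x => a * h x) ≤ a * X.associateNorm h := by
  refine iSup_le fun g => iSup_le fun hg => iSup_le fun hg1 => ?_
  simp only [mul_assoc]
  rw [lintegral_const_mul' _ _ ENNReal.coe_ne_top]
  gcongr
  exact X.lintegral_mul_le_associateNorm hg hg1

theorem associateNorm_congr {f g : α → ℝ≥0∞} (h : f =ᵐ[μ] g) :
    X.associateNorm f = X.associateNorm g := by
  refine iSup_congr fun k => iSup_congr fun _ => iSup_congr fun _ => lintegral_congr_ae ?_
  filter_upwards [h] with x hx
  rw [hx]

/-- Multiples of indicators of sets of finite measure are admissible test functions, so `f` is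
integrable over each such set. -/
theorem ae_lt_top_of_associateNorm_lt_top [SigmaFinite μ] {f : α → ℝ≥0∞} (hf : AEMeasurable f μ)
    (h : X.associateNorm f < ∞) : ∀ᵐ x ∂μ, f x < ∞ := by
  have hE : ∀ k : ℕ, ∀ᵐ x ∂μ.restrict (spanningSets μ k), f x < ∞ := by
    intro k
    set E := spanningSets μ k
    have hEm : MeasurableSet E := measurableSet_spanningSets μ k
    have hfin := X.norm_indicator_lt_top E hEm (measure_spanningSets_lt_top μ k)
    have h1m : AEMeasurable (E.indicator fun _ => (1 : ℝ≥0∞)) μ :=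
      aemeasurable_const.indicator hEm
    set a : ℝ≥0 := (X.norm (E.indicator fun _ => 1)).toNNReal + 1 with ha
    have ha0 : a ≠ 0 := by positivity
    have hle : X.norm (E.indicator fun _ => 1) ≤ a := by
      rw [ha, ENNReal.coe_add, ENNReal.coe_toNNReal hfin.ne]
      exact le_self_add
    have h1 : X.norm (fun x => ((a⁻¹ : ℝ≥0) : ℝ≥0∞) * E.indicator (fun _ => 1) x) ≤ 1 := by
      rw [X.norm_smul _ _ h1m, ENNReal.coe_inv ha0]
      refine le_trans ?_ (ENNReal.inv_mul_le_one (a : ℝ≥0∞))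
      gcongr
    have h2 := X.lintegral_mul_le_associateNorm (f := f) (h1m.const_mul _) h1
    have h3 : ∫⁻ x, f x * (((a⁻¹ : ℝ≥0) : ℝ≥0∞) * E.indicator (fun _ => 1) x) ∂μ =
        ((a⁻¹ : ℝ≥0) : ℝ≥0∞) * ∫⁻ x in E, f x ∂μ := by
      rw [← lintegral_indicator hEm, ← lintegral_const_mul' _ _ ENNReal.coe_ne_top]
      refine lintegral_congr fun x => ?_
      by_cases hx : x ∈ E <;> simp [hx, mul_comm]
    rw [h3] at h2
    refine ae_lt_top' hf.restrict (ENNReal.lt_top_of_mul_ne_top_right (h2.trans_lt h).ne ?_).ne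
    exact ENNReal.coe_ne_zero.2 (inv_ne_zero ha0)
  have := (ae_restrict_iUnion_iff (μ := μ) (spanningSets μ) fun x => f x < ∞).2 hE
  rwa [iUnion_spanningSets, Measure.restrict_univ] at this

end BanachFunctionSpace

/-! ### `Lˢ` as a countably sublinear functional -/

section Lp

variable {α : Type*} [MeasurableSpace α] {μ : Measure α}

theorem lintegral_sum_range_rpow_le {s : ℝ} (hs : 1 ≤ s) {h : ℕ → α → ℝ≥0∞}
    (hh : ∀ k, AEMeasurable (h k) μ) (N : ℕ) :
    (∫⁻ x, (∑ k ∈ Finset.range N, h k x) ^ s ∂μ) ^ (1 / s) ≤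
      ∑ k ∈ Finset.range N, (∫⁻ x, h k x ^ s ∂μ) ^ (1 / s) := by
  have hs0 : 0 < s := by linarith
  induction N with
  | zero => simp [hs0]
  | succ N ih =>
    rw [Finset.sum_range_succ]
    simp only [Finset.sum_range_succ]
    refine (ENNReal.lintegral_Lp_add_le (f := fun x => ∑ k ∈ Finset.range N, h k x)
      (Finset.aemeasurable_fun_sum _ fun k _ => hh k) (hh N) hs).trans ?_
    gcongr

theorem isCountablySublinear_Lp {s : ℝ} (hs : 1 ≤ s) :
    IsCountablySublinear μ fun h => (∫⁻ x, h x ^ s ∂μ) ^ (1 / s) := by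
  have hs0 : 0 < s := by linarith
  refine ⟨fun h hh => ?_, fun a h _ => ?_, fun h hh hfin => ?_⟩
  · have hlim : Tendsto (fun N => (∫⁻ x, (∑ k ∈ Finset.range N, h k x) ^ s ∂μ) ^ (1 / s)) atTop
        (𝓝 ((∫⁻ x, (∑' k, h k x) ^ s ∂μ) ^ (1 / s))) := by
      refine ((ENNReal.continuous_rpow_const.tendsto _).comp ?_)
      refine lintegral_tendsto_of_tendsto_of_monotone
        (fun N => (Finset.aemeasurable_fun_sum _ fun k _ => hh k).pow_const s)
        (ae_of_all _ fun x M N hMN => ?_) (ae_of_all _ fun x => ?_)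
      · exact ENNReal.rpow_le_rpow
          (Finset.sum_le_sum_of_subset (Finset.range_mono hMN)) hs0.le
      · exact (ENNReal.continuous_rpow_const.tendsto _).comp (ENNReal.tendsto_nat_tsum _)
    exact le_of_tendsto hlim (Eventually.of_forall fun N =>
      (lintegral_sum_range_rpow_le hs hh N).trans (ENNReal.sum_le_tsum _))
  · simp only [ENNReal.mul_rpow_of_nonneg _ _ hs0.le]
    rw [lintegral_const_mul' _ _ (ENNReal.rpow_ne_top_of_nonneg hs0.le ENNReal.coe_ne_top),
      ENNReal.mul_rpow_of_nonneg _ _ (by positivity), ← ENNReal.rpow_mul, mul_one_div_cancel hs0.ne',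
      ENNReal.rpow_one]
  · have h1 : ∫⁻ x, h x ^ s ∂μ ≠ ∞ := by
      intro h2
      rw [h2, ENNReal.top_rpow_of_pos (by positivity)] at hfin
      exact lt_irrefl _ hfin
    filter_upwards [ae_lt_top' (hh.pow_const s) h1] with x hx
    exact (ENNReal.rpow_lt_top_iff_of_pos hs0).1 hx

/-- The converse of Hölder's inequality, tested on the normalised power `f^{r-1}`. Truncation makes
the normalising integral finite. -/
theorem lintegral_rpow_le_of_forall_lintegral_mul_le [SigmaFinite μ] {r s : ℝ}
    (hrs : r.HolderConjugate s) {f : α → ℝ≥0∞} (hf : AEMeasurable f μ) {A : ℝ≥0∞}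
    (hA : ∀ h, AEMeasurable h μ → (∫⁻ x, h x ^ s ∂μ) ^ (1 / s) ≤ 1 → ∫⁻ x, f x * h x ∂μ ≤ A) :
    ∫⁻ x, f x ^ r ∂μ ≤ A ^ r := by
  have hr0 := hrs.pos
  have hs0 := hrs.symm.pos
  have hr1 : 0 < r - 1 := hrs.sub_one_pos
  have hlim : Tendsto (fun k => ∫⁻ x, truncate μ f k x ^ r ∂μ) atTop (𝓝 (∫⁻ x, f x ^ r ∂μ)) :=
    lintegral_tendsto_of_tendsto_of_monotone
      (fun k => (aemeasurable_truncate hf k).pow_const r)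
      (ae_of_all _ fun x j k hjk => ENNReal.rpow_le_rpow (monotone_truncate x hjk) hr0.le)
      (ae_of_all _ fun x => (ENNReal.continuous_rpow_const.tendsto _).comp (tendsto_truncate x))
  refine le_of_tendsto hlim (Eventually.of_forall fun k => ?_)
  set T := ∫⁻ x, truncate μ f k x ^ r ∂μ with hT
  have hT1 : T ≠ ∞ := (lintegral_truncate_rpow_lt_top hr0 k).ne
  rcases eq_or_ne T 0 with hT0 | hT0
  · rw [hT0]
    exact zero_le
  have hTs : T ^ (-(1 / s)) ≠ ∞ := ENNReal.rpow_ne_top_of_ne_zero hT0 hT1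
  have htm := aemeasurable_truncate hf k
  have h1 := hA (fun x => T ^ (-(1 / s)) * truncate μ f k x ^ (r - 1))
    ((htm.pow_const _).const_mul _) (by
      have : ∀ x, (T ^ (-(1 / s)) * truncate μ f k x ^ (r - 1)) ^ s =
          T⁻¹ * truncate μ f k x ^ r := by
        intro x
        rw [ENNReal.mul_rpow_of_nonneg _ _ hs0.le, ← ENNReal.rpow_mul, ← ENNReal.rpow_mul,
          hrs.sub_one_mul_conj, neg_mul, one_div_mul_cancel hs0.ne', ENNReal.rpow_neg_one]
      simp only [this]
      rw [lintegral_const_mul' _ _ (ENNReal.inv_ne_top.2 hT0), ← hT,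
        ENNReal.inv_mul_cancel hT0 hT1, ENNReal.one_rpow])
  have h2 : T ^ (1 / r) ≤ A := by
    refine le_trans (le_of_eq ?_) ((lintegral_mono fun x =>
      mul_le_mul_left (truncate_le (μ := μ) (f := f) k x) _).trans h1)
    have : ∀ x, truncate μ f k x * (T ^ (-(1 / s)) * truncate μ f k x ^ (r - 1)) =
        T ^ (-(1 / s)) * truncate μ f k x ^ r := by
      intro x
      have : truncate μ f k x ^ r = truncate μ f k x * truncate μ f k x ^ (r - 1) := by
        conv_lhs => rw [show r = 1 + (r - 1) by ring]
        rw [ENNReal.rpow_add_of_nonneg _ _ zero_le_one hr1.le, ENNReal.rpow_one]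
      rw [this]
      ring
    simp only [this]
    rw [lintegral_const_mul' _ _ hTs, ← hT]
    conv_rhs => rw [← ENNReal.rpow_one T, ← ENNReal.rpow_mul, ← ENNReal.rpow_add _ _ hT0 hT1]
    congr 1
    have := hrs.inv_add_inv_eq_one
    rw [one_div, one_div]
    linarith
  calc T = (T ^ (1 / r)) ^ r := by
        rw [← ENNReal.rpow_mul, one_div_mul_cancel hr0.ne', ENNReal.rpow_one]
    _ ≤ A ^ r := ENNReal.rpow_le_rpow h2 hr0.le

end Lp

/-! ### Extrapolation of weighted inequalities -/

/-- The pairs in `F` satisfy the weighted `Lᵖ` inequality for every `A_∞` weight. -/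
def LpComparison {n : ℕ} (F : Set (((Fin n → ℝ) → ℝ≥0∞) × ((Fin n → ℝ) → ℝ≥0∞))) (p : ℝ) : Prop :=
  ∀ w : (Fin n → ℝ) → ℝ≥0∞, IsAInfty w → ∃ C : ℝ≥0, ∀ fg ∈ F,
    ∫⁻ x, fg.1 x ^ p ∂(weightMeasure w) ≤ C * ∫⁻ x, fg.2 x ^ p ∂(weightMeasure w)

section Extrapolation

variable {n : ℕ} {F : Set (((Fin n → ℝ) → ℝ≥0∞) × ((Fin n → ℝ) → ℝ≥0∞))} {p₀ p : ℝ}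

theorem tsum_inv_two_pow : ∑' N : ℕ, (2⁻¹ : ℝ≥0∞) ^ N = 2 := by
  rw [ENNReal.tsum_geometric, ENNReal.one_sub_inv_two, inv_inv]

/-- Uniformity in the dual function is obtained by gluing a sequence of counterexamples. -/
theorem LpComparison.exists_dual_bound (hF : LpComparison F p)
    {w : (Fin n → ℝ) → ℝ≥0∞} (hw : IsAInfty w) {Φ : ((Fin n → ℝ) → ℝ≥0∞) → ℝ≥0∞}
    (hΦ : IsCountablySublinear (weightMeasure w) Φ) {K : ℝ≥0} (hK : 0 < K)
    (hM : ∀ f, AEMeasurable f (weightMeasure w) →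
      Φ (maximalFunction (weightMeasure w) f) ≤ K * Φ f) :
    ∃ C : ℝ≥0, ∀ fg ∈ F, ∀ S : ℝ≥0∞,
      (∀ k, AEMeasurable k (weightMeasure w) → Φ k ≤ 1 →
        ∫⁻ x, fg.2 x ^ p * k x ∂(weightMeasure w) ≤ S) →
      ∀ h, AEMeasurable h (weightMeasure w) → Φ h ≤ 1 →
        ∫⁻ x, fg.1 x ^ p * h x ∂(weightMeasure w) ≤ C * S := by
  have := hw.isLocallyFiniteMeasure
  by_contra! hcon
  -- The growth `4 ^ N` leaves a margin `2 ^ N` after the loss `2 ^ N` from the coefficients `2⁻ᴺ`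
  -- of `H`.
  choose fg hfg S hS h hh hh1 hlt using fun N : ℕ => hcon (4 ^ N)
  set H : (Fin n → ℝ) → ℝ≥0∞ := fun x => ∑' N, (((2⁻¹ : ℝ≥0) ^ N : ℝ≥0) : ℝ≥0∞) * h N x
  have hHm : AEMeasurable H (weightMeasure w) := AEMeasurable.tsum fun N => (hh N).const_mul _
  have hHΦ : Φ H ≤ 2 := by
    refine (hΦ.tsum_le _ fun N => (hh N).const_mul _).trans ?_
    rw [← tsum_inv_two_pow]
    refine ENNReal.tsum_le_tsum fun N => (hΦ.const_mul_le _ _ (hh N)).trans ?_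
    refine (mul_le_of_le_one_right' (hh1 N)).trans_eq ?_
    rw [ENNReal.coe_pow, ENNReal.coe_inv two_ne_zero, ENNReal.coe_ofNat]
  have hle : ∀ N x, h N x ≤ 2 ^ N * H x := by
    intro N x
    have h1 : (((2⁻¹ : ℝ≥0) ^ N : ℝ≥0) : ℝ≥0∞) * h N x ≤ H x :=
      ENNReal.le_tsum (f := fun N => (((2⁻¹ : ℝ≥0) ^ N : ℝ≥0) : ℝ≥0∞) * h N x) N
    calc h N x = 2 ^ N * ((((2⁻¹ : ℝ≥0) ^ N : ℝ≥0) : ℝ≥0∞) * h N x) := by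
          rw [← mul_assoc, ENNReal.coe_pow, ENNReal.coe_inv two_ne_zero, ENNReal.coe_ofNat,
            ← mul_pow, ENNReal.mul_inv_cancel two_ne_zero ENNReal.ofNat_ne_top, one_pow, one_mul]
      _ ≤ 2 ^ N * H x := by gcongr
  have hH0 : ¬ H =ᵐ[weightMeasure w] 0 := by
    intro h0
    refine (zero_le.trans_lt (hlt 0)).ne' ((lintegral_eq_zero_of_ae_eq_zero ?_))
    filter_upwards [h0] with x hx
    have := hle 0 x
    rw [hx, Pi.zero_apply, mul_zero, nonpos_iff_eq_zero] at this
    simp [this]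
  set k := rubioDeFrancia (weightMeasure w) K H with hk
  have hkm : AEMeasurable k (weightMeasure w) := aemeasurable_rubioDeFrancia hHm
  have hkΦ : Φ k ≤ 4 := by
    refine (hΦ.rubioDeFrancia_le hK hM hHm).trans ?_
    calc 2 * Φ H ≤ 2 * 2 := by gcongr
      _ = 4 := by norm_num
  have hkw : IsWeight k := by
    refine ⟨hw.1.aemeasurable_iff.1 hkm, hw.1.ae_iff.1 ?_⟩
    filter_upwards [hΦ.ae_lt_top k hkm (hkΦ.trans_lt (by simp))] with x hx
    exact ⟨rubioDeFrancia_pos hK hHm hH0 x, hx⟩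
  obtain ⟨C, hC⟩ := hF _ (hw.mul_of_maximalFunction_le hkw
    fun x => maximalFunction_rubioDeFrancia_le hK hHm x)
  obtain ⟨N, hN⟩ := pow_unbounded_of_one_lt (4 * C) one_lt_two
  refine absurd (hlt N) (not_lt.2 ?_)
  have hgk : ∫⁻ x, (fg N).2 x ^ p * k x ∂(weightMeasure w) ≤ 4 * S N := by
    have h1 := hS N (fun x => ((4⁻¹ : ℝ≥0) : ℝ≥0∞) * k x) (hkm.const_mul _)
      ((hΦ.const_mul_le _ _ hkm).trans (by
        rw [ENNReal.coe_inv four_ne_zero, ENNReal.coe_ofNat]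
        refine le_trans ?_ (ENNReal.inv_mul_le_one 4)
        gcongr))
    calc ∫⁻ x, (fg N).2 x ^ p * k x ∂(weightMeasure w)
        = 4 * ∫⁻ x, (fg N).2 x ^ p * (((4⁻¹ : ℝ≥0) : ℝ≥0∞) * k x) ∂(weightMeasure w) := by
          rw [← lintegral_const_mul' _ _ ENNReal.ofNat_ne_top]
          refine lintegral_congr fun x => ?_
          rw [mul_left_comm 4, ENNReal.coe_inv four_ne_zero, ENNReal.coe_ofNat, ← mul_assoc 4,
            ENNReal.mul_inv_cancel four_ne_zero ENNReal.ofNat_ne_top, one_mul]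
      _ ≤ 4 * S N := by gcongr
  calc ∫⁻ x, (fg N).1 x ^ p * h N x ∂(weightMeasure w)
      ≤ ∫⁻ x, 2 ^ N * ((fg N).1 x ^ p * k x) ∂(weightMeasure w) := by
        refine lintegral_mono fun x => ?_
        rw [mul_left_comm]
        gcongr
        exact (hle N x).trans (mul_le_mul_right (le_rubioDeFrancia x) _)
    _ = 2 ^ N * ∫⁻ x, (fg N).1 x ^ p * k x ∂(weightMeasure w) :=
        lintegral_const_mul' _ _ (by finiteness)
    _ ≤ 2 ^ N * (C * ∫⁻ x, (fg N).2 x ^ p * k x ∂(weightMeasure w)) := by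
        have := hC _ (hfg N)
        rw [hw.1.lintegral_weightMeasure_mul hkw, hw.1.lintegral_weightMeasure_mul hkw] at this
        exact mul_le_mul_right this _
    _ ≤ 2 ^ N * (C * (4 * S N)) := by gcongr
    _ = 2 ^ N * ((4 * C : ℝ≥0) : ℝ≥0∞) * S N := by
        push_cast
        ring
    _ ≤ 2 ^ N * ((2 ^ N : ℝ≥0) : ℝ≥0∞) * S N := by gcongr
    _ = ((4 ^ N : ℝ≥0) : ℝ≥0∞) * S N := by
        push_cast
        rw [← mul_pow]
        norm_num

/-- Duality in `L^{p/p₀}(w)`: the dual bound applies with `Φ` the conjugate Lebesgue norm. -/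
theorem LpComparison.of_lt (hF : LpComparison F p₀)
    (hFm : ∀ fg ∈ F, AEMeasurable fg.1 volume ∧ AEMeasurable fg.2 volume)
    (hp₀ : 0 < p₀) (hp : p₀ < p) : LpComparison F p := by
  intro w hw
  have := hw.isLocallyFiniteMeasure
  have hr : 1 < p / p₀ := (one_lt_div hp₀).2 hp
  have hrs : (p / p₀).HolderConjugate (p / p₀).conjExponent := Real.HolderConjugate.conjExponent hr
  set r := p / p₀ with hrdef
  set s := r.conjExponent
  have hr0 : 0 < r := hrs.pos
  have hs0 : 0 < s := hrs.symm.pos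
  have hp₀r : p₀ * r = p := by rw [hrdef]; field_simp
  obtain ⟨A, hA⟩ := hw.exists_lintegral_maximalFunction_rpow_le hrs.symm.lt
  -- Adding 1 only ensures that the bound for the maximal operator is positive.
  obtain ⟨C, hC⟩ := hF.exists_dual_bound hw (isCountablySublinear_Lp hrs.symm.lt.le)
    (K := A ^ (1 / s) + 1) (by positivity) fun f hf => by
      refine (ENNReal.rpow_le_rpow (hA f hf) (by positivity)).trans ?_
      rw [ENNReal.mul_rpow_of_nonneg _ _ (by positivity)]
      gcongr
      rw [ENNReal.coe_add, ENNReal.coe_rpow_of_nonneg _ (by positivity)]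
      exact le_self_add
  refine ⟨C ^ r, fun fg hfg => ?_⟩
  have hfm := hw.1.aemeasurable_iff.2 (hFm fg hfg).1
  have hgm := hw.1.aemeasurable_iff.2 (hFm fg hfg).2
  have h1 := hC fg hfg ((∫⁻ x, fg.2 x ^ p ∂(weightMeasure w)) ^ (1 / r)) fun k hk hk1 => by
    refine (ENNReal.lintegral_mul_le_Lp_mul_Lq _ hrs (hgm.pow_const p₀) hk).trans ?_
    simp only [← ENNReal.rpow_mul, hp₀r]
    exact mul_le_of_le_one_right' hk1
  have h2 := lintegral_rpow_le_of_forall_lintegral_mul_le hrs (hfm.pow_const p₀) h1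
  rw [ENNReal.mul_rpow_of_nonneg _ _ hr0.le, ← ENNReal.rpow_mul, one_div_mul_cancel hr0.ne',
    ENNReal.rpow_one, ← ENNReal.coe_rpow_of_nonneg _ hr0.le] at h2
  simpa only [← ENNReal.rpow_mul, hp₀r] using h2

theorem lintegral_rpow_eq_zero_iff {α : Type*} [MeasurableSpace α] {μ : Measure α}
    {f : α → ℝ≥0∞} (hf : AEMeasurable f μ) {a : ℝ} (ha : 0 < a) :
    ∫⁻ x, f x ^ a ∂μ = 0 ↔ f =ᵐ[μ] 0 := by
  rw [lintegral_eq_zero_iff' (hf.pow_const a)]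
  refine eventually_congr (ae_of_all _ fun x => ?_)
  simp [ha, ha.not_gt]

/-- Here `k = R H` must dominate a multiple of a power of each `g`, so that `k⁻ᵗ` trades `g^{p₀}`
for `g^p`. Hölder then recovers `∫ f^p w` from `∫ f^{p₀} k⁻ᵗ w` and `∫ k² w`. -/
theorem LpComparison.of_gt (hF : LpComparison F p₀)
    (hFm : ∀ fg ∈ F, AEMeasurable fg.1 volume ∧ AEMeasurable fg.2 volume)
    (hp : 0 < p) (hpp : p < p₀) : LpComparison F p := by
  intro w hw
  have := hw.isLocallyFiniteMeasure
  have hp₀ : 0 < p₀ := hp.trans hpp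
  set μ := weightMeasure w
  set s := p₀ / p with hs
  have hs1 : 1 < s := (one_lt_div hp).2 hpp
  have hs0 : 0 < s := by linarith
  have hps : p * s = p₀ := by rw [hs]; field_simp
  -- This `t` gives both `g^{p₀} = g^p (g^{p/2})ᵗ` and `-t/s + 2(s-1)/s = 0`, the cancellation of
  -- `k` in Hölder's inequality.
  set t := 2 * (s - 1) with ht
  have ht0 : 0 < t := by linarith
  by_contra! hcon
  -- The factor `(2^N)^{t/s}` absorbs the loss from the coefficients of `H`; the spare `2^N` must
  -- exceed the fixed constant `B`.
  choose fg hfg hlt using fun N : ℕ => hcon (((2 : ℝ≥0) ^ N) ^ (t / s) * 2 ^ N)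
  have hfm := fun N => hw.1.aemeasurable_iff.2 (hFm _ (hfg N)).1
  have hgm := fun N => hw.1.aemeasurable_iff.2 (hFm _ (hfg N)).2
  set G : ℕ → ℝ≥0∞ := fun N => ∫⁻ x, (fg N).2 x ^ p ∂μ with hG
  have hG0 : ∀ N, G N ≠ 0 := by
    intro N h0
    obtain ⟨C, hC⟩ := hF w hw
    have h1 := hC _ (hfg N)
    rw [(lintegral_rpow_eq_zero_iff (hgm N) hp₀).2 ((lintegral_rpow_eq_zero_iff (hgm N) hp).1 h0),
      mul_zero, nonpos_iff_eq_zero, lintegral_rpow_eq_zero_iff (hfm N) hp₀] at h1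
    exact (zero_le.trans_lt (hlt N)).ne' ((lintegral_rpow_eq_zero_iff (hfm N) hp).2 h1)
  have hG1 : ∀ N, G N ≠ ∞ := by
    intro N h0
    have h1 := hlt N
    change _ * G N < _ at h1
    rw [h0, ENNReal.mul_top (ENNReal.coe_ne_zero.2 (by positivity))] at h1
    exact not_top_lt h1
  have hΦ : IsCountablySublinear μ fun h => (∫⁻ x, h x ^ (2 : ℝ) ∂μ) ^ (1 / (2 : ℝ)) :=
    isCountablySublinear_Lp one_le_two
  set Φ : ((Fin n → ℝ) → ℝ≥0∞) → ℝ≥0∞ := fun h => (∫⁻ x, h x ^ (2 : ℝ) ∂μ) ^ (1 / (2 : ℝ))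
  obtain ⟨A, hA⟩ := hw.exists_lintegral_maximalFunction_rpow_le one_lt_two
  set K : ℝ≥0 := A ^ (1 / (2 : ℝ)) + 1
  have hK : 0 < K := by positivity
  have hM : ∀ f, AEMeasurable f μ → Φ (maximalFunction μ f) ≤ K * Φ f := by
    intro f hf
    refine (ENNReal.rpow_le_rpow (hA f hf) (by positivity)).trans ?_
    rw [ENNReal.mul_rpow_of_nonneg _ _ (by positivity)]
    gcongr
    rw [ENNReal.coe_add, ENNReal.coe_rpow_of_nonneg _ (by positivity)]
    exact le_self_add
  -- `G N ^ (1/2)` is the `L²(w)` norm of `g^{p/2}`, so dividing by `b N` leaves a term of norm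
  -- `2⁻ᴺ`.
  set b : ℕ → ℝ≥0 := fun N => 2 ^ N * (G N).toNNReal ^ (1 / (2 : ℝ)) with hb
  have hbG : ∀ N, (b N : ℝ≥0∞) = 2 ^ N * G N ^ (1 / (2 : ℝ)) := by
    intro N
    rw [hb, ENNReal.coe_mul, ENNReal.coe_rpow_of_nonneg _ (by positivity),
      ENNReal.coe_toNNReal (hG1 N)]
    norm_num
  have hGr0 : ∀ N, G N ^ (1 / (2 : ℝ)) ≠ 0 := fun N =>
    (ENNReal.rpow_pos (pos_iff_ne_zero.2 (hG0 N)) (hG1 N)).ne'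
  have hGr1 : ∀ N, G N ^ (1 / (2 : ℝ)) ≠ ∞ := fun N =>
    ENNReal.rpow_ne_top_of_nonneg (by positivity) (hG1 N)
  have hb0 : ∀ N, b N ≠ 0 := by
    intro N h0
    have h1 := hbG N
    rw [h0, ENNReal.coe_zero] at h1
    exact mul_ne_zero (by positivity) (hGr0 N) h1.symm
  set φ : ℕ → (Fin n → ℝ) → ℝ≥0∞ := fun N x => (fg N).2 x ^ (p / 2) with hφ
  have hφm : ∀ N, AEMeasurable (φ N) μ := fun N => (hgm N).pow_const _
  have hφΦ : ∀ N, Φ (φ N) = G N ^ (1 / (2 : ℝ)) := by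
    intro N
    simp only [Φ, φ, G, ← ENNReal.rpow_mul]
    rw [div_mul_cancel₀ p two_ne_zero]
  set H : (Fin n → ℝ) → ℝ≥0∞ := fun x => ∑' N, (((b N)⁻¹ : ℝ≥0) : ℝ≥0∞) * φ N x with hH
  have hHm : AEMeasurable H μ := AEMeasurable.tsum fun N => (hφm N).const_mul _
  have hHΦ : Φ H ≤ 2 := by
    refine (hΦ.tsum_le _ fun N => (hφm N).const_mul _).trans ?_
    rw [← tsum_inv_two_pow]
    refine ENNReal.tsum_le_tsum fun N => (hΦ.const_mul_le _ _ (hφm N)).trans_eq ?_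
    rw [hφΦ, ENNReal.coe_inv (hb0 N), hbG,
      ENNReal.mul_inv (Or.inl (by positivity)) (Or.inl (by finiteness)), mul_assoc,
      ENNReal.inv_mul_cancel (hGr0 N) (hGr1 N), mul_one, ENNReal.inv_pow]
  have hle : ∀ N x, φ N x ≤ b N * H x := by
    intro N x
    have h1 : (((b N)⁻¹ : ℝ≥0) : ℝ≥0∞) * φ N x ≤ H x :=
      ENNReal.le_tsum (f := fun N => (((b N)⁻¹ : ℝ≥0) : ℝ≥0∞) * φ N x) N
    calc φ N x = b N * ((((b N)⁻¹ : ℝ≥0) : ℝ≥0∞) * φ N x) := by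
          rw [← mul_assoc, ← ENNReal.coe_mul, mul_inv_cancel₀ (hb0 N), ENNReal.coe_one, one_mul]
      _ ≤ b N * H x := by gcongr
  have hH0 : ¬ H =ᵐ[μ] 0 := by
    intro h0
    apply hG0 0
    rw [lintegral_rpow_eq_zero_iff (hgm 0) hp]
    filter_upwards [h0] with x hx
    have h1 := hle 0 x
    rw [hx, Pi.zero_apply, mul_zero, nonpos_iff_eq_zero] at h1
    exact (ENNReal.rpow_eq_zero_iff_of_pos (by positivity)).1 h1
  set k := rubioDeFrancia μ K H with hk
  have hkm : AEMeasurable k μ := aemeasurable_rubioDeFrancia hHm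
  have hkΦ : Φ k ≤ 4 := by
    refine (hΦ.rubioDeFrancia_le hK hM hHm).trans ?_
    calc 2 * Φ H ≤ 2 * 2 := by gcongr
      _ = 4 := by norm_num
  have hkw : IsWeight k := by
    refine ⟨hw.1.aemeasurable_iff.1 hkm, hw.1.ae_iff.1 ?_⟩
    filter_upwards [hΦ.ae_lt_top k hkm (hkΦ.trans_lt (by simp))] with x hx
    exact ⟨rubioDeFrancia_pos hK hHm hH0 x, hx⟩
  have hk2 : ∫⁻ x, k x ^ (2 : ℝ) ∂μ ≤ 4 ^ (2 : ℝ) := by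
    refine le_trans (le_of_eq ?_) (ENNReal.rpow_le_rpow hkΦ zero_le_two)
    rw [← ENNReal.rpow_mul, one_div_mul_cancel two_ne_zero, ENNReal.rpow_one]
  obtain ⟨C, hC⟩ := hF _ (hw.rpow_neg_mul_of_maximalFunction_le hkw
    (fun x => maximalFunction_rubioDeFrancia_le hK hHm x) ht0)
  set B : ℝ≥0 := C ^ (1 / s) * ((4 : ℝ≥0) ^ (2 : ℝ)) ^ ((s - 1) / s) with hB
  obtain ⟨N, hN⟩ := pow_unbounded_of_one_lt B one_lt_two
  have hs10 : 0 ≤ (s - 1) / s := div_nonneg (by linarith) hs0.le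
  have hs11 : 0 ≤ 1 / s := by positivity
  have hkae := hw.1.ae_iff.2 hkw.2
  have hgk : ∫⁻ x, (fg N).2 x ^ p₀ * k x ^ (-t) ∂μ ≤ (2 ^ N) ^ t * G N ^ s := by
    calc ∫⁻ x, (fg N).2 x ^ p₀ * k x ^ (-t) ∂μ
        ≤ ∫⁻ x, (b N : ℝ≥0∞) ^ t * (fg N).2 x ^ p ∂μ := by
          refine lintegral_mono_ae ?_
          filter_upwards [hkae] with x hx
          have e1 : (fg N).2 x ^ p₀ = (fg N).2 x ^ p * φ N x ^ t := by
            rw [hφ]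
            simp only []
            rw [← ENNReal.rpow_mul, ← ENNReal.rpow_add_of_nonneg _ _ hp.le (by positivity)]
            congr 1
            rw [ht, ← hps]
            ring
          calc (fg N).2 x ^ p₀ * k x ^ (-t)
              ≤ (fg N).2 x ^ p * (b N * k x) ^ t * k x ^ (-t) := by
                rw [e1]
                gcongr
                exact (hle N x).trans (mul_le_mul_right (le_rubioDeFrancia x) _)
            _ = (b N : ℝ≥0∞) ^ t * (fg N).2 x ^ p * (k x ^ t * k x ^ (-t)) := by
                rw [ENNReal.mul_rpow_of_nonneg _ _ ht0.le]
                ring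
            _ = (b N : ℝ≥0∞) ^ t * (fg N).2 x ^ p := by
                rw [← ENNReal.rpow_add _ _ hx.1.ne' hx.2.ne, add_neg_cancel, ENNReal.rpow_zero,
                  mul_one]
      _ = (b N : ℝ≥0∞) ^ t * G N :=
          lintegral_const_mul' _ _ (ENNReal.rpow_ne_top_of_nonneg ht0.le ENNReal.coe_ne_top)
      _ = (2 ^ N) ^ t * (G N ^ (t / 2) * G N ^ (1 : ℝ)) := by
          rw [hbG, ENNReal.mul_rpow_of_nonneg _ _ ht0.le, ← ENNReal.rpow_mul, ENNReal.rpow_one,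
            mul_assoc, one_div_mul_eq_div]
      _ = (2 ^ N) ^ t * G N ^ s := by
          rw [← ENNReal.rpow_add _ _ (hG0 N) (hG1 N)]
          congr 2
          rw [ht]
          ring
  have hfk : ∫⁻ x, (fg N).1 x ^ p₀ * k x ^ (-t) ∂μ ≤ C * ((2 ^ N) ^ t * G N ^ s) := by
    have h1 := hC _ (hfg N)
    rw [hw.1.lintegral_weightMeasure_mul (hkw.rpow (-t)),
      hw.1.lintegral_weightMeasure_mul (hkw.rpow (-t))] at h1
    exact h1.trans (mul_le_mul_right hgk _)
  refine absurd (hlt N) (not_lt.2 ?_)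
  calc ∫⁻ x, (fg N).1 x ^ p ∂μ
      = ∫⁻ x, ((fg N).1 x ^ p₀ * k x ^ (-t)) ^ (1 / s) * (k x ^ (2 : ℝ)) ^ ((s - 1) / s) ∂μ := by
        refine lintegral_congr_ae ?_
        filter_upwards [hkae] with x hx
        rw [ENNReal.mul_rpow_of_nonneg _ _ hs11, ← ENNReal.rpow_mul, ← ENNReal.rpow_mul,
          ← ENNReal.rpow_mul, mul_assoc, ← ENNReal.rpow_add _ _ hx.1.ne' hx.2.ne,
          show -t * (1 / s) + 2 * ((s - 1) / s) = 0 by rw [ht]; ring, ENNReal.rpow_zero, mul_one,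
          ← hps, mul_assoc, mul_one_div_cancel hs0.ne', mul_one]
    _ ≤ (∫⁻ x, (fg N).1 x ^ p₀ * k x ^ (-t) ∂μ) ^ (1 / s) *
          (∫⁻ x, k x ^ (2 : ℝ) ∂μ) ^ ((s - 1) / s) :=
        ENNReal.lintegral_mul_norm_pow_le (((hfm N).pow_const _).mul (hkm.pow_const _))
          (hkm.pow_const _) hs11 hs10 (by field_simp; ring)
    _ ≤ (C * ((2 ^ N) ^ t * G N ^ s)) ^ (1 / s) * (4 ^ (2 : ℝ)) ^ ((s - 1) / s) := by gcongr
    _ = B * ((2 ^ N) ^ (t / s) * G N) := by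
        rw [ENNReal.mul_rpow_of_nonneg _ _ hs11, ENNReal.mul_rpow_of_nonneg _ _ hs11,
          ← ENNReal.rpow_mul, ← ENNReal.rpow_mul, mul_one_div_cancel hs0.ne', ENNReal.rpow_one,
          mul_one_div, hB, ENNReal.coe_mul, ENNReal.coe_rpow_of_nonneg _ hs11,
          ENNReal.coe_rpow_of_nonneg _ hs10, ENNReal.coe_rpow_of_nonneg _ zero_le_two,
          ENNReal.coe_ofNat]
        ring
    _ ≤ ((2 ^ N : ℝ≥0) : ℝ≥0∞) * ((2 ^ N) ^ (t / s) * G N) := by gcongr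
    _ = _ := by
        rw [ENNReal.coe_mul, ENNReal.coe_rpow_of_nonneg _ (by positivity)]
        push_cast
        ring

theorem LpComparison.of_pos (hF : LpComparison F p₀)
    (hFm : ∀ fg ∈ F, AEMeasurable fg.1 volume ∧ AEMeasurable fg.2 volume)
    (hp₀ : 0 < p₀) (hp : 0 < p) : LpComparison F p := by
  rcases lt_trichotomy p₀ p with h | rfl | h
  · exact hF.of_lt hFm hp₀ h
  · exact hF
  · exact hF.of_gt hFm hp h

/-! ### Passage to Banach function spaces and to vector-valued inequalities -/

theorem isCountablySublinear_associateNorm {u v : (Fin n → ℝ) → ℝ≥0∞} (hu : IsWeight u)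
    (hv : IsAInfty v) (X : BanachFunctionSpace (weightMeasure v)) :
    IsCountablySublinear (weightMeasure v) fun h => X.associateNorm fun x => h x * (u x)⁻¹ := by
  have := hv.isLocallyFiniteMeasure
  have hum : AEMeasurable (fun x => (u x)⁻¹) (weightMeasure v) := (hv.1.aemeasurable_iff.2 hu.1).inv
  refine ⟨fun h hh => ?_, fun a h _ => ?_, fun h hh hfin => ?_⟩
  · simp only [← ENNReal.tsum_mul_right]
    exact X.associateNorm_tsum_le fun k => (hh k).mul hum
  · simp only [mul_assoc]
    exact X.associateNorm_const_mul_le a _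
  · filter_upwards [X.ae_lt_top_of_associateNorm_lt_top (hh.mul hum) hfin, hv.1.ae_iff.2 hu.2]
      with x hx hux
    exact ENNReal.lt_top_of_mul_ne_top_left hx.ne (ENNReal.inv_ne_zero.2 hux.2.ne)

/-- Replacing a dual function `h` by `h u` turns the pairing with `f^p u` into one with `f^p`, and
the norm of `h` in `X'` into `Φ (h u)`. Hölder in `X` bounds the `g` side, and the second associate
norm recovers the `f` side. -/
theorem LpComparison.exists_norm_le (hF : LpComparison F p)
    (hFm : ∀ fg ∈ F, AEMeasurable fg.1 volume ∧ AEMeasurable fg.2 volume)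
    {u v : (Fin n → ℝ) → ℝ≥0∞} (hu : IsWeight u) (hv : IsAInfty v)
    (X : BanachFunctionSpace (weightMeasure v)) {K : ℝ≥0}
    (hM : ∀ f : (Fin n → ℝ) → ℝ≥0∞, AEMeasurable f volume →
      X.associateNorm (fun x => weightedMaximal v f x * (u x)⁻¹) ≤
        K * X.associateNorm (fun x => f x * (u x)⁻¹)) :
    ∃ C : ℝ≥0, ∀ fg ∈ F,
      X.norm (fun x => fg.1 x ^ p * u x) ≤ C * X.norm (fun x => fg.2 x ^ p * u x) := by
  have := hv.isLocallyFiniteMeasure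
  have hum := hv.1.aemeasurable_iff.2 hu.1
  have huae := hv.1.ae_iff.2 hu.2
  obtain ⟨C, hC⟩ := hF.exists_dual_bound hv (isCountablySublinear_associateNorm hu hv X)
    (K := K + 1) (by positivity) fun f hf => by
      refine (hM f (hv.1.aemeasurable_iff.1 hf)).trans ?_
      gcongr
      exact le_self_add
  refine ⟨C, fun fg hfg => ?_⟩
  have hfm := hv.1.aemeasurable_iff.2 (hFm fg hfg).1
  have hgm := hv.1.aemeasurable_iff.2 (hFm fg hfg).2
  have hcancel : ∀ x, 0 < u x ∧ u x < ∞ → u x * (u x)⁻¹ = 1 := fun x hx =>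
    ENNReal.mul_inv_cancel hx.1.ne' hx.2.ne
  have h1 := hC fg hfg (X.norm fun x => fg.2 x ^ p * u x) fun k hk hk1 => by
    refine le_trans (le_of_eq ?_) (X.lintegral_mul_le ((hgm.pow_const p).mul hum) hk1)
    refine lintegral_congr_ae ?_
    filter_upwards [huae] with x hx
    calc fg.2 x ^ p * k x = fg.2 x ^ p * k x * (u x * (u x)⁻¹) := by rw [hcancel x hx, mul_one]
      _ = _ := by ring
  refine X.norm_le_of_forall_lintegral_mul_le ((hfm.pow_const p).mul hum) fun h hh hh1 => ?_
  have hcongr : (fun x => h x * u x * (u x)⁻¹) =ᵐ[weightMeasure v] h := by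
    filter_upwards [huae] with x hx
    rw [mul_assoc, hcancel x hx, mul_one]
  refine le_trans (le_of_eq (lintegral_congr fun x => ?_))
    (h1 (fun x => h x * u x) (hh.mul hum) ((X.associateNorm_congr hcongr).trans_le hh1))
  rw [Pi.mul_apply]
  ring

/-- The family of `ℓ^q` sums of pairs from `F`. -/
def lqSums (F : Set (((Fin n → ℝ) → ℝ≥0∞) × ((Fin n → ℝ) → ℝ≥0∞))) (q : ℝ) :
    Set (((Fin n → ℝ) → ℝ≥0∞) × ((Fin n → ℝ) → ℝ≥0∞)) :=
  {fg | ∃ (ι : Type) (_ : Countable ι)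
    (a : ι → ((Fin n → ℝ) → ℝ≥0∞) × ((Fin n → ℝ) → ℝ≥0∞)), (∀ j, a j ∈ F) ∧
      fg = (fun x => (∑' j, (a j).1 x ^ q) ^ (1 / q), fun x => (∑' j, (a j).2 x ^ q) ^ (1 / q))}

theorem aemeasurable_of_mem_lqSums
    (hFm : ∀ fg ∈ F, AEMeasurable fg.1 volume ∧ AEMeasurable fg.2 volume) {q : ℝ} :
    ∀ fg ∈ lqSums F q, AEMeasurable fg.1 volume ∧ AEMeasurable fg.2 volume := by
  rintro _ ⟨ι, _, a, ha, rfl⟩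
  exact ⟨(AEMeasurable.tsum fun j => (hFm _ (ha j)).1.pow_const q).pow_const _,
    (AEMeasurable.tsum fun j => (hFm _ (ha j)).2.pow_const q).pow_const _⟩

/-- At exponent `q` the outer power disappears, so integral and sum interchange and one constant
serves every sequence. -/
theorem LpComparison.lqSums {q : ℝ} (hF : LpComparison F q)
    (hFm : ∀ fg ∈ F, AEMeasurable fg.1 volume ∧ AEMeasurable fg.2 volume) (hq : 0 < q) :
    LpComparison (lqSums F q) q := by
  intro w hw
  obtain ⟨C, hC⟩ := hF w hw
  refine ⟨C, ?_⟩
  rintro _ ⟨ι, _, a, ha, rfl⟩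
  simp only [← ENNReal.rpow_mul, one_div_mul_cancel hq.ne', ENNReal.rpow_one]
  rw [lintegral_tsum fun j => (hw.1.aemeasurable_iff.2 (hFm _ (ha j)).1).pow_const q,
    lintegral_tsum fun j => (hw.1.aemeasurable_iff.2 (hFm _ (ha j)).2).pow_const q,
    ← ENNReal.tsum_mul_left]
  exact ENNReal.tsum_le_tsum fun j => hC _ (ha j)

theorem lpComparison_of_weightedLpNorm_le (hp₀ : 0 < p₀)
    (hyp : ∀ w : (Fin n → ℝ) → ℝ≥0∞, IsAInfty w →
      ∃ C : ℝ≥0, ∀ fg ∈ F, weightedLpNorm p₀ w fg.1 ≤ C * weightedLpNorm p₀ w fg.2) :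
    LpComparison F p₀ := by
  intro w hw
  obtain ⟨C, hC⟩ := hyp w hw
  refine ⟨C ^ p₀, fun fg hfg => ?_⟩
  have h := ENNReal.rpow_le_rpow (hC fg hfg) hp₀.le
  rw [weightedLpNorm, weightedLpNorm, ENNReal.mul_rpow_of_nonneg _ _ hp₀.le, ← ENNReal.rpow_mul,
    ← ENNReal.rpow_mul, one_div_mul_cancel hp₀.ne', ENNReal.rpow_one, ENNReal.rpow_one,
    ← ENNReal.coe_rpow_of_nonneg _ hp₀.le] at h
  exact h

end Extrapolation

theorem theorem3p4 {n : ℕ} (hn : 1 ≤ n)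
    (u v : (Fin n → ℝ) → ℝ≥0∞) (hu : IsWeight u) (hv : IsWeight v)
    (hvA : IsAInfty v) (hvloc : IsLocIntegrable v)
    (X : BanachFunctionSpace (weightMeasure v))
    (F : Set (((Fin n → ℝ) → ℝ≥0∞) × ((Fin n → ℝ) → ℝ≥0∞)))
    (hF : ∀ fg ∈ F, AEMeasurable fg.1 volume ∧ AEMeasurable fg.2 volume)
    (p₀ : ℝ) (hp₀ : 0 < p₀)
    (hyp : ∀ w : (Fin n → ℝ) → ℝ≥0∞, IsAInfty w →
      ∃ C : ℝ≥0, ∀ fg ∈ F, weightedLpNorm p₀ w fg.1 ≤ C * weightedLpNorm p₀ w fg.2)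
    (K₀ : ℝ≥0)
    (hM : ∀ f : (Fin n → ℝ) → ℝ≥0∞, AEMeasurable f volume →
      X.associateNorm (fun x => weightedMaximal v f x * (u x)⁻¹) ≤
        K₀ * X.associateNorm (fun x => f x * (u x)⁻¹)) :
    (∀ p : ℝ, 0 < p → ∃ C : ℝ≥0, ∀ fg ∈ F,
      X.norm (fun x => fg.1 x ^ p * u x) ≤ C * X.norm (fun x => fg.2 x ^ p * u x)) ∧
    (∀ p q : ℝ, 0 < p → 0 < q → ∃ C : ℝ≥0, ∀ (ι : Type) [Countable ι]
      (fg : ι → ((Fin n → ℝ) → ℝ≥0∞) × ((Fin n → ℝ) → ℝ≥0∞)), (∀ j, fg j ∈ F) →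
      X.norm (fun x => (∑' j, (fg j).1 x ^ q) ^ (p / q) * u x) ≤
        C * X.norm (fun x => (∑' j, (fg j).2 x ^ q) ^ (p / q) * u x)) := by
  have hF₀ := lpComparison_of_weightedLpNorm_le hp₀ hyp
  refine ⟨fun p hp => (hF₀.of_pos hF hp₀ hp).exists_norm_le hF hu hvA X hM,
    fun p q hp hq => ?_⟩
  have hFq := aemeasurable_of_mem_lqSums hF (q := q)
  -- Extrapolation is used twice: to reach exponent `q`, where the sums can be handled, and then,
  -- for the family of sums, to go from `q` to `p`.
  obtain ⟨C, hC⟩ := (((hF₀.of_pos hF hp₀ hq).lqSums hF hq).of_pos hFq hq hp).exists_norm_le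
    hFq hu hvA X hM
  refine ⟨C, fun ι _ fg hfg => ?_⟩
  have h := hC _ ⟨ι, inferInstance, fg, hfg, rfl⟩
  simpa only [← ENNReal.rpow_mul, one_div_mul_eq_div] using h
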